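/- Let $\mathcal{A}$ be an abelian category and $\mathrm{D}^b(\mathcal{A})$ its bounded derived category (cochain complexes). Notation. For $M\in \mathrm{D}^b(\mathcal{A})$ put $\sup M=\sup\{i\in\mathbb{Z}\mid \mathrm{H}^iM\neq 0\}$ and $\inf M=\inf\{i\in\mathbb{Z}\mid \mathrm{H}^iM\neq 0\}$. For a full isomorphism-closed subcategory $\mathcal{X}$ of $\mathcal{A}$ and $M\neq 0$, the $\mathcal{X}$-resolution dimension of $M$ is the infimum in $\mathbb{Z}\cup\{\pm\infty\}$ of the integers $n$ such that $M$ is isomorphic in the derived category to a complex $0\to X^{-n}\to\cdots\to X^{\sup M}\to 0$ with all $X^i\in\mathcal{X}$; the $\mathcal{X}$-coresolution dimension of $M$ is the infimum of the integers $n$ such that $M$ is isomorphic to a complex $0\to X^{\inf M}\to\cdots\to X^{n}\to 0$ with all $X^i\in\mathcal{X}$ (the infimum of the empty set being $+\infty$). Let $\mathrm{proj}\,\mathcal{A}$ and $\mathrm{inj}\,\mathcal{A}$ be the classes of projective and of injective objects. An object is Gorenstein projective if it is isomorphic to $\mathrm{Coker}(P^{-1}\to P^0)$ for some exact complex $P=(\cdots\to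 P^{-1}\to P^0\to P^1\to\cdots)$ of projective objects such that $\mathrm{Hom}_{\mathcal{A}}(P,Q)$ is exact for all projective $Q$; it is Gorenstein injective if it is isomorphic to $\mathrm{Ker}(I^0\to I^1)$ for some exact complex $I$ of injective objects such that $\mathrm{Hom}_{\mathcal{A}}(J,I)$ is exact for all injective $J$. The classes of these objects are $\mathrm{Gproj}\,\mathcal{A}$ and $\mathrm{Ginj}\,\mathcal{A}$. Let $\mathrm{pd}$ and $\mathrm{Gpd}$ denote the resolution dimensions with respect to $\mathrm{proj}\,\mathcal{A}$ and $\mathrm{Gproj}\,\mathcal{A}$, and $\mathrm{id}$ and $\mathrm{Gid}$ the coresolution dimensions with respect to $\mathrm{inj}\,\mathcal{A}$ and $\mathrm{Ginj}\,\mathcal{A}$. For a class $\mathcal{X}$ of objects of a triangulated category $\mathcal{T}$, let $\langle\mathcal{X}\rangle$ consist of the direct summands of finite direct sums of shifts $\Sigma^nX$ ($n\in\mathbb{Z}$, $X\in\mathcal{X}$). Let $\mathcal{X}*\mathcal{Y}$ consist of the objects $E$ that fit into an exact triangle $X\to E\to Y\to\Sigma X$ with $X\in\mathcal{X}$, $Y\in\mathcal{Y}$.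 Put $\langle\mathcal{X}\rangle_0=0$, $\langle\mathcal{X}\rangle_1=\langle\mathcal{X}\rangle$, and $\langle\mathcal{X}\rangle_r=\langle\langle\mathcal{X}\rangle_{r-1}*\langle\mathcal{X}\rangle\rangle$ for $r>1$. The level of $M\in\mathcal{T}$ is $\mathrm{level}^{\mathcal{X}}M=\inf\{r\ge 0\mid M\in\langle\mathcal{X}\rangle_r\}\in\mathbb{Z}_{\ge 0}\cup\{\infty\}$. For a subcategory $\mathcal{X}$ of $\mathcal{A}$, $\mathrm{level}^{\mathcal{X}}$ is taken in $\mathcal{T}=\mathrm{D}^b(\mathcal{A})$ with respect to the essential image of $\mathcal{X}$ under the embedding of $\mathcal{A}$ in degree $0$. Statement. (1) If $\mathcal{A}$ has enough projective objects, then for every nonzero $M\in \mathrm{D}^b(\mathcal{A})$ $$\mathrm{level}^{\mathrm{proj}\,\mathcal{A}}M\ \ge\ \mathrm{pd}\,M+\inf M+1 \quad\text{and}\quad \mathrm{level}^{\mathrm{Gproj}\,\mathcal{A}}M\ \ge\ \mathrm{Gpd}\,M+\inf M+1.$$ (2) If $\mathcal{A}$ has enough injective objects, then for every nonzero $M\in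 \mathrm{D}^b(\mathcal{A})$ $$\mathrm{level}^{\mathrm{inj}\,\mathcal{A}}M\ \ge\ \mathrm{id}\,M-\sup M+1 \quad\text{and}\quad \mathrm{level}^{\mathrm{Ginj}\,\mathcal{A}}M\ \ge\ \mathrm{Gid}\,M-\sup M+1.$$ -/

import Mathlib

open CategoryTheory CategoryTheory.Limits CategoryTheory.Pretriangulated

universe w v u

namespace LevelBound

noncomputable section

/-! ### Levels in triangulated categories -/

section Level

variable {T : Type u} [Category.{v} T] [Preadditive T]

/-- The additive closure of `P`: the direct summands of finite (possibly empty) direct sums of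
objects of `P`. -/
def addClosure [HasBinaryBiproducts T] (P : ObjectProperty T) : ObjectProperty T := fun M =>
  ∃ (n : ℕ) (f : Fin n → T) (b : Bicone f) (N : T),
    (∀ i, P (f i)) ∧ Nonempty b.IsBilimit ∧ Nonempty (M ⊞ N ≅ b.pt)

variable [HasZeroObject T] [HasShift T ℤ] [∀ n : ℤ, (shiftFunctor T n).Additive]
  [Pretriangulated T]

/-- `⟨P⟩`: the additive closure of the class of all shifts `X⟦n⟧`, with `n : ℤ` and `X` in `P`. -/
def angle (P : ObjectProperty T) : ObjectProperty T := addClosure (P.shiftClosure ℤ)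

/-- `⟨P⟩_r`: the zero objects for `r = 0`, `⟨P⟩` for `r = 1`, and `⟨⟨P⟩_{r-1} * ⟨P⟩⟩` for `r > 1`,
where `E` lies in `X * Y` if there is an exact triangle `X ⟶ E ⟶ Y ⟶ X⟦1⟧` with `X` in the
first class and `Y` in the second. -/
def angleIter (P : ObjectProperty T) : ℕ → ObjectProperty T
  | 0 => fun M => IsZero M
  | 1 => angle P
  | r + 2 => angle (ObjectProperty.extensionProduct (angleIter P (r + 1)) (angle P))

/-- The `P`-level of `M`: the infimum of the `r ≥ 0` with `M` in `⟨P⟩_r`; it is `⊤` if there is no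
such `r`. -/
def level (P : ObjectProperty T) (M : T) : EReal :=
  sInf {x : EReal | ∃ r : ℕ, angleIter P r M ∧ x = (r : EReal)}

end Level

/-! ### Cohomological bounds and (co)resolution dimensions -/

section Derived

variable {A : Type u} [Category.{v} A] [Abelian A] [HasDerivedCategory.{w} A]

/-- `sup M = sup {i : ℤ | Hⁱ M ≠ 0}`. -/
def cohSup (M : DerivedCategory A) : EReal :=
  sSup {x : EReal | ∃ i : ℤ,
    ¬ IsZero ((DerivedCategory.homologyFunctor A i).obj M) ∧ x = ((i : ℝ) : EReal)}

/-- `inf M = inf {i : ℤ | Hⁱ M ≠ 0}`. -/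
def cohInf (M : DerivedCategory A) : EReal :=
  sInf {x : EReal | ∃ i : ℤ,
    ¬ IsZero ((DerivedCategory.homologyFunctor A i).obj M) ∧ x = ((i : ℝ) : EReal)}

/-- `M` is isomorphic in the derived category to a complex
`0 ⟶ X^a ⟶ ⋯ ⟶ X^b ⟶ 0` with all `X^i`, `a ≤ i ≤ b`, in `P` (and `X^i = 0` for other `i`). -/
def IsoComplexIn (P : ObjectProperty A) (a b : EReal) (M : DerivedCategory A) : Prop :=
  ∃ X : CochainComplex A ℤ,
    (∀ i : ℤ, a ≤ ((i : ℝ) : EReal) → ((i : ℝ) : EReal) ≤ b → P (X.X i)) ∧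
    (∀ i : ℤ, ¬ (a ≤ ((i : ℝ) : EReal) ∧ ((i : ℝ) : EReal) ≤ b) → IsZero (X.X i)) ∧
    Nonempty (DerivedCategory.Q.obj X ≅ M)

open Classical in
/-- The `P`-resolution dimension of `M` (which is meant for `M` with right-bounded cohomology):
the infimum of the integers `n` such that `M` is isomorphic to a complex
`0 ⟶ X^{-n} ⟶ ⋯ ⟶ X^{sup M} ⟶ 0` of objects of `P`. It is `-∞` for `M = 0`. -/
def resolDim (P : ObjectProperty A) (M : DerivedCategory A) : EReal :=
  if IsZero M then ⊥ else
    sInf {x : EReal | ∃ n : ℤ, IsoComplexIn P (-((n : ℝ) : EReal)) (cohSup M) M ∧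
      x = ((n : ℝ) : EReal)}

open Classical in
/-- The `P`-coresolution dimension of `M` (which is meant for `M` with left-bounded cohomology):
the infimum of the integers `n` such that `M` is isomorphic to a complex
`0 ⟶ X^{inf M} ⟶ ⋯ ⟶ X^n ⟶ 0` of objects of `P`. It is `-∞` for `M = 0`. -/
def coresolDim (P : ObjectProperty A) (M : DerivedCategory A) : EReal :=
  if IsZero M then ⊥ else
    sInf {x : EReal | ∃ n : ℤ, IsoComplexIn P (cohInf M) ((n : ℝ) : EReal) M ∧
      x = ((n : ℝ) : EReal)}

variable (A) in
/-- The functor from `A` to its bounded derived category that places an object in degree `0`. -/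
def toBounded : A ⥤ DerivedCategory.Bounded A :=
  ObjectProperty.lift _ (DerivedCategory.singleFunctor A 0)
    (fun _ => ⟨⟨0, inferInstance⟩, ⟨0, inferInstance⟩⟩)

/-- The `P`-level of `M` in the bounded derived category, where `P` is identified with its
essential image under `toBounded A`. -/
def levelBounded (P : ObjectProperty A) (M : DerivedCategory.Bounded A) : EReal :=
  level (P.map (toBounded A)) M

end Derived

/-! ### (Gorenstein) projective and injective objects and dimensions -/

section Gorenstein

variable (A : Type u) [Category.{v} A] [Abelian A]

/-- The class `Gproj A` of Gorenstein projective objects: `M` is isomorphic to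
`C⁰ P = Coker (P^{-1} ⟶ P^0)` for an exact complex `P` of projective objects such that `Hom(P, Q)`
is exact for all projective objects `Q`. -/
def Gproj : ObjectProperty A := fun M =>
  ∃ P : CochainComplex A ℤ, P.Acyclic ∧ (∀ i, Projective (P.X i)) ∧
    (∀ Q : A, Projective Q → ∀ i, ((P.sc i).op.map (preadditiveYoneda.obj Q)).Exact) ∧
    Nonempty (M ≅ P.opcycles 0)

/-- The class `Ginj A` of Gorenstein injective objects: `M` is isomorphic to
`Z⁰ I = Ker (I^0 ⟶ I^1)` for an exact complex `I` of injective objects such that `Hom(J, I)`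
is exact for all injective objects `J`. -/
def Ginj : ObjectProperty A := fun M =>
  ∃ I : CochainComplex A ℤ, I.Acyclic ∧ (∀ i, Injective (I.X i)) ∧
    (∀ J : A, Injective J → ∀ i,
      ((I.sc i).map (preadditiveCoyoneda.obj (Opposite.op J))).Exact) ∧
    Nonempty (M ≅ I.cycles 0)

variable {A} [HasDerivedCategory.{w} A]

/-- The projective dimension of a complex. -/
def pd (M : DerivedCategory A) : EReal := resolDim (isProjective A) M

/-- The Gorenstein projective dimension of a complex. -/
def Gpd (M : DerivedCategory A) : EReal := resolDim (Gproj A) M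

/-- The injective dimension of a complex. -/
def injDim (M : DerivedCategory A) : EReal := coresolDim (isInjective A) M

/-- The Gorenstein injective dimension of a complex. -/
def Gid (M : DerivedCategory A) : EReal := coresolDim (Ginj A) M

end Gorenstein

end

end LevelBound

/-!
The bound is a ghost lemma. The functor from the bounded derived category to the derived category
`D` is exact, so it does not increase levels (`angleIter_map`), and the argument takes place in a
triangulated category with a t-structure whose heart has enough projective objects; the canonical
t-structure of `D` gives the resolution dimensions, and its opposite (`opTStructure`) gives the
coresolution dimensions.

Let `G` be a class of objects of the heart that is closed under extensions, direct summands and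
kernels of epimorphisms, contains the projective objects, has no higher extensions with them, and
whose objects embed into projective objects with cokernels in `G` (`IsResolving`). The projective
objects form such a class, and so do the Gorenstein projective ones. Bounded complexes of objects
of `G` are handled as iterated extensions of shifts of objects of `G` (`tower`). Since syzygies do
not depend on the resolution by which they are computed, up to membership in `G`, the objects that
are represented by such complexes form a thick subcategory (`boundedTower_isTriangulated`,
`boundedTower_isStableUnderRetracts`). Hence an object `M` of finite level with cohomology in the
degrees `i, …, s` is represented by a bounded complex of objects of `G` in degrees `≤ s`, and its
terms in degrees `< i` may be replaced by projective objects (`tower_succ_le`).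

The quotient maps that cut off the terms of degrees `≥ i`, then the term of degree `i - 1`, then
the one of degree `i - 2`, and so on, are `G`-ghosts: each goes from an object with cohomology in
degrees `≥ j` to a complex of projective objects in degrees `< j` (`isGhost_of_tower`). A
composition of `r + 1` ghosts vanishes on an object of level at most `r + 1`
(`angleIter_le_ghostKernel`), so `M` is a direct summand of its brutal truncation in the degrees
`i - r, …, s`, and therefore is represented by a complex of objects of `G` in these degrees
(`tower_of_ghostKernel`). This says that the `G`-resolution dimension is at most `r - i`. Passage
to the opposite category reverses the order of the factors in the definition of the level, so that
the ghost lemma is also needed for the reversed order (`one_extensionProduct_le_ghostKernel`).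

It remains to go back to complexes in an abelian category. A tower is turned into a complex by
successive mapping cones (`hasComplexIn_of_tower`, `hasComplexIn_of_tower_op`). The Gorenstein
projective objects of a heart are defined coinductively (`heartGproj`), by which the closure
properties in `IsResolving` become formal; complete resolutions correspond to classes that are
closed under cosyzygies and syzygies (`IsCosyzygyClosed`), from whose short exact sequences they
are spliced (`gproj_of_isCosyzygyClosed`, `ginj_of_isCosyzygyClosed`).

For classes of objects `P` and `Q` of a triangulated category, `P ∗ Q` denotes the class of the
extensions of objects of `Q` by objects of `P`.
-/

set_option linter.unusedSectionVars false

local infixr:70 " ∗ " => CategoryTheory.ObjectProperty.extensionProduct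

namespace LevelBound

open Triangulated ObjectProperty ZeroObject

/-! ### Extension products of classes of objects -/

section ExtensionProducts

variable {T : Type u} [Category.{v} T] [Preadditive T] [HasZeroObject T] [HasShift T ℤ]
  [∀ n : ℤ, (shiftFunctor T n).Additive] [Pretriangulated T]

lemma extensionProduct_mono {P P' Q Q' : ObjectProperty T} (h : P ≤ P') (h' : Q ≤ Q') :
    P ∗ Q ≤ P' ∗ Q' :=
  (monotone_extensionProduct_left Q h).trans (monotone_extensionProduct_right P' h')

lemma extensionProduct_shift_le (P Q : ObjectProperty T) (n : ℤ) :
    P.shift n ∗ Q.shift n ≤ (P ∗ Q).shift n := by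
  rintro X ⟨Y, Z, f, g, h, hT, hY, hZ⟩
  exact ⟨_, _, _, _, _, Triangle.shift_distinguished _ hT n, hY, hZ⟩

lemma shift_mono {P Q : ObjectProperty T} (h : P ≤ Q) (n : ℤ) : P.shift n ≤ Q.shift n :=
  fun _ hX => h _ hX

lemma extensionProduct_shift (P Q : ObjectProperty T) [P.IsClosedUnderIsomorphisms]
    [Q.IsClosedUnderIsomorphisms] (n : ℤ) :
    (P ∗ Q).shift n = P.shift n ∗ Q.shift n := by
  refine le_antisymm ?_ (extensionProduct_shift_le P Q n)
  have h := shift_mono (extensionProduct_shift_le (P.shift n) (Q.shift n) (-n)) n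
  rwa [shift_shift _ _ _ _ (neg_add_cancel n), shift_shift _ _ _ _ (neg_add_cancel n),
    shift_shift _ _ _ _ (add_neg_cancel n), shift_zero, shift_zero, shift_zero] at h

lemma extensionProduct_le_of_isZero_left {Z P : ObjectProperty T} [P.IsClosedUnderIsomorphisms]
    (hZ : ∀ X, Z X → IsZero X) : Z ∗ P ≤ P := by
  rintro X ⟨Y, W, f, g, h, hT, hY, hW⟩
  have : IsIso g := (Triangle.isZero₁_iff_isIso₂ _ hT).1 (hZ _ hY)
  exact P.prop_of_iso (asIso g).symm hW

lemma extensionProduct_le_of_isZero_right {Z P : ObjectProperty T} [P.IsClosedUnderIsomorphisms]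
    (hZ : ∀ X, Z X → IsZero X) : P ∗ Z ≤ P := by
  rintro X ⟨Y, W, f, g, h, hT, hY, hW⟩
  have : IsIso f := (Triangle.isZero₃_iff_isIso₁ _ hT).1 (hZ _ hW)
  exact P.prop_of_iso (asIso f) hY

/-- If all morphisms `Y ⟶ X⟦1⟧` with `X` in `P` and `Y` in `Q` are zero, the extensions of `Q` by
`P` split, so that the order of `P` and `Q` may be exchanged. -/
lemma extensionProduct_swap {P Q : ObjectProperty T}
    (h : ∀ X Y, P X → Q Y → ∀ f : Y ⟶ X⟦(1 : ℤ)⟧, f = 0) : P ∗ Q ≤ Q ∗ P := by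
  rintro E ⟨X, Y, f, g, δ, hT, hX, hY⟩
  obtain ⟨e, -, -⟩ := exists_iso_binaryBiproduct_of_distTriang _ hT (h X Y hX hY δ)
  exact (Q ∗ P).prop_of_iso ((biprod.braiding _ _).symm ≪≫ e.symm : Y ⊞ X ≅ E)
    ⟨_, _, _, _, _, binaryBiproductTriangle_distinguished Y X, hY, hX⟩

lemma extensionProduct_biprod {P Q : ObjectProperty T} {X Y : T} (hX : P X) (hY : Q Y) :
    (P ∗ Q) (X ⊞ Y) :=
  ⟨_, _, _, _, _, binaryBiproductTriangle_distinguished X Y, hX, hY⟩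

/-- The morphisms from an object of `P` to an object of `Q` are zero. -/
def HomZero (P Q : ObjectProperty T) : Prop := P ≤ Q.leftOrthogonal

lemma HomZero.eq_zero {P Q : ObjectProperty T} (h : HomZero P Q) {X Y : T} (hX : P X) (hY : Q Y)
    (f : X ⟶ Y) : f = 0 := h _ hX f hY

lemma HomZero.mono {P P' Q Q' : ObjectProperty T} (h : HomZero P Q) (hP : P' ≤ P) (hQ : Q' ≤ Q) :
    HomZero P' Q' := fun _ hX _ f hY => h _ (hP _ hX) f (hQ _ hY)

lemma HomZero.extensionProduct_left {P P' Q : ObjectProperty T} (h : HomZero P Q)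
    (h' : HomZero P' Q) : HomZero (P ∗ P') Q :=
  extensionProduct_le_of_isTriangulatedClosed₂ h h'

lemma HomZero.extensionProduct_right {P Q Q' : ObjectProperty T} (h : HomZero P Q)
    (h' : HomZero P Q') : HomZero P (Q ∗ Q') := by
  rintro X hX Y f ⟨A, B, i, p, δ, hT, hA, hB⟩
  obtain ⟨g, hg⟩ : ∃ g : X ⟶ A, f = g ≫ i :=
    Triangle.coyoneda_exact₂ _ hT f (h'.eq_zero hX hB _)
  rw [hg, h.eq_zero hX hA g, zero_comp]

lemma HomZero.shift {P Q : ObjectProperty T} (h : HomZero P Q) (n : ℤ) :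
    HomZero (P.shift n) (Q.shift n) := fun X hX Y f hY =>
  (shiftFunctor T n).map_injective (by rw [Functor.map_zero]; exact h.eq_zero hX hY _)

lemma exists_distTriang_of_iso {Tr : Triangle T} (hTr : Tr ∈ distTriang T) {X Y Z : T}
    (e₁ : X ≅ Tr.obj₁) (e₂ : Y ≅ Tr.obj₂) (e₃ : Z ≅ Tr.obj₃) :
    ∃ (i : X ⟶ Y) (p : Y ⟶ Z) (δ : Z ⟶ X⟦(1 : ℤ)⟧), Triangle.mk i p δ ∈ distTriang T := by
  have h₁ : (e₁.hom ≫ Tr.mor₁ ≫ e₂.inv) ≫ e₂.hom = e₁.hom ≫ Tr.mor₁ := by simp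
  have h₂ : (e₂.hom ≫ Tr.mor₂ ≫ e₃.inv) ≫ e₃.hom = e₂.hom ≫ Tr.mor₂ := by simp
  have h₃ : (e₃.hom ≫ Tr.mor₃ ≫ e₁.inv⟦(1 : ℤ)⟧') ≫ e₁.hom⟦(1 : ℤ)⟧' = e₃.hom ≫ Tr.mor₃ := by
    simp [← Functor.map_comp]
  exact ⟨_, _, _, isomorphic_distinguished _ hTr _ (Triangle.isoMk _ _ e₁ e₂ e₃ h₁ h₂ h₃)⟩

/-- The objects of two distinguished triangles have direct sums that form a distinguished
triangle. -/
lemma exists_distTriang_biprod {X Y Z X' Y' Z' : T} {f : Y ⟶ X} {g : X ⟶ Z}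
    {h : Z ⟶ Y⟦(1 : ℤ)⟧} {f' : Y' ⟶ X'} {g' : X' ⟶ Z'} {h' : Z' ⟶ Y'⟦(1 : ℤ)⟧}
    (hT : Triangle.mk f g h ∈ distTriang T) (hT' : Triangle.mk f' g' h' ∈ distTriang T) :
    ∃ (i : Y ⊞ Y' ⟶ X ⊞ X') (p : X ⊞ X' ⟶ Z ⊞ Z') (δ : Z ⊞ Z' ⟶ (Y ⊞ Y')⟦(1 : ℤ)⟧),
      Triangle.mk i p δ ∈ distTriang T := by
  let t : WalkingPair → Triangle T := fun j => WalkingPair.casesOn j (Triangle.mk f g h)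
    (Triangle.mk f' g' h')
  have ht : ∀ j, t j ∈ distTriang T := by rintro (_ | _) <;> assumption
  have key (F : WalkingPair → T) : Nonempty (F .left ⊞ F .right ≅ ∏ᶜ F) :=
    ⟨{ hom := Pi.lift fun j => WalkingPair.casesOn j biprod.fst biprod.snd
       inv := biprod.lift (Pi.π F .left) (Pi.π F .right)
       hom_inv_id := by ext <;> simp
       inv_hom_id := by ext (_ | _) <;> simp }⟩
  obtain ⟨e₁⟩ := key (fun j => (t j).obj₁)
  obtain ⟨e₂⟩ := key (fun j => (t j).obj₂)
  obtain ⟨e₃⟩ := key (fun j => (t j).obj₃)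
  exact exists_distTriang_of_iso (productTriangle_distinguished t ht) e₁ e₂ e₃

/-- A retract in a pretriangulated category is a direct summand, with the cone as complement. -/
lemma nonempty_iso_biprod_of_retract {X Y Z : T} (r : Retract X Y) {g : Y ⟶ Z}
    {h : Z ⟶ X⟦(1 : ℤ)⟧} (hT : Triangle.mk r.i g h ∈ distTriang T) : Nonempty (Y ≅ X ⊞ Z) := by
  have h0 : h = 0 := by
    have h1 : h ≫ r.i⟦(1 : ℤ)⟧' = 0 := comp_distTriang_mor_zero₃₁ _ hT
    have h2 : h ≫ (r.i ≫ r.r)⟦(1 : ℤ)⟧' = 0 := by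
      rw [Functor.map_comp, reassoc_of% h1, zero_comp]
    simpa using h2
  obtain ⟨e, -, -⟩ := exists_iso_binaryBiproduct_of_distTriang _ hT h0
  exact ⟨e⟩

end ExtensionProducts

/-! ### Projective objects and resolving classes in the heart of a t-structure -/

section Resolving

variable {T : Type u} [Category.{v} T] [Preadditive T] [HasZeroObject T] [HasShift T ℤ]
  [∀ n : ℤ, (shiftFunctor T n).Additive] [Pretriangulated T] (t : TStructure T)

/-- The class of projective objects of the heart of `t`, seen in the triangulated category: the
objects of the heart without nonzero morphisms to objects that are `≤ -1`. -/
def heartProj : ObjectProperty T := t.heart ⊓ (t.le (-1)).leftOrthogonal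

/-- A class `G` of objects of the heart of `t` behaves like a resolving class whose objects are
Gorenstein projective: it contains the projective objects of the heart, its objects have no higher
extensions with projective objects, each of them embeds into a projective object with cokernel in
`G`, and `G` is closed under extensions, direct summands and kernels of epimorphisms. -/
class IsResolving (G : ObjectProperty T) : Prop extends G.IsStableUnderRetracts where
  heartProj_le : heartProj t ≤ G
  le_heart : G ≤ t.heart
  homZero (k : ℤ) (hk : k < 0) : HomZero G ((heartProj t).shift k)
  le_cosyzygy : G ≤ G.shift (1 : ℤ) ∗ heartProj t
  extension_le : G ∗ G ≤ G
  kernel_le : (G.shift (1 : ℤ) ∗ G) ⊓ t.le 0 ≤ G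

variable {t}

lemma le_extensionProduct_le (n : ℤ) : t.le n ∗ t.le n ≤ t.le n := by
  rintro X ⟨Y, Z, f, g, h, hT, hY, hZ⟩
  exact (t.isLE₂ _ hT n ⟨hY⟩ ⟨hZ⟩).le

lemma ge_extensionProduct_ge (n : ℤ) : t.ge n ∗ t.ge n ≤ t.ge n := by
  rintro X ⟨Y, Z, f, g, h, hT, hY, hZ⟩
  exact (t.isGE₂ _ hT n ⟨hY⟩ ⟨hZ⟩).ge

lemma homZero_le_ge {a b : ℤ} (h : a < b) : HomZero (t.le a) (t.ge b) :=
  fun _ hX _ f hY => t.zero_of_isLE_of_isGE f a b h ⟨hX⟩ ⟨hY⟩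

lemma isZero_of_le_of_ge {X : T} {a b : ℤ} (h : a < b) (hX : t.le a X) (hX' : t.ge b X) :
    IsZero X := by
  have : t.IsLE X a := ⟨hX⟩
  have : t.IsGE X b := ⟨hX'⟩
  exact t.isZero X a b h

lemma le_of_isZero {X : T} (hX : IsZero X) (n : ℤ) : t.le n X := (t.isLE_of_isZero hX n).le

lemma ge_of_isZero {X : T} (hX : IsZero X) (n : ℤ) : t.ge n X := (t.isGE_of_isZero hX n).ge

lemma le_eq_leftOrthogonal (n : ℤ) : t.le n = (t.ge (n + 1)).leftOrthogonal := by
  ext X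
  rw [t.le_iff_isLE, t.isLE_iff_orthogonal n (n + 1) rfl]
  exact ⟨fun h Y f hY => h Y f ⟨hY⟩, fun h Y f hY => h f hY.ge⟩

lemma ge_eq_rightOrthogonal (n : ℤ) : t.ge n = (t.le (n - 1)).rightOrthogonal := by
  ext X
  rw [t.ge_iff_isGE, t.isGE_iff_orthogonal (n - 1) n (by lia)]
  exact ⟨fun h Y f hY => h Y f ⟨hY⟩, fun h Y f hY => h f hY.le⟩

instance (P : ObjectProperty T) : P.leftOrthogonal.IsStableUnderRetracts where
  of_retract r hY Z f hZ := by
    rw [← Category.id_comp f, ← r.retract, Category.assoc, hY (r.r ≫ f) hZ, comp_zero]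

instance (P : ObjectProperty T) : P.rightOrthogonal.IsStableUnderRetracts where
  of_retract r hY Z f hZ := by
    rw [← Category.comp_id f, ← r.retract, ← Category.assoc, hY (f ≫ r.i) hZ, zero_comp]

instance (n : ℤ) : (t.le n).IsStableUnderRetracts := by
  rw [le_eq_leftOrthogonal]; infer_instance

instance (n : ℤ) : (t.ge n).IsStableUnderRetracts := by
  rw [ge_eq_rightOrthogonal]; infer_instance

instance (P Q : ObjectProperty T) [P.IsStableUnderRetracts] [Q.IsStableUnderRetracts] :
    (P ⊓ Q).IsStableUnderRetracts where
  of_retract r h := ⟨P.prop_of_retract r h.1, Q.prop_of_retract r h.2⟩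

instance : t.heart.IsStableUnderRetracts :=
  inferInstanceAs (t.le 0 ⊓ t.ge 0).IsStableUnderRetracts

instance : (heartProj t).IsStableUnderRetracts :=
  inferInstanceAs (t.heart ⊓ (t.le (-1)).leftOrthogonal).IsStableUnderRetracts

lemma heartProj_of_isZero {X : T} (hX : IsZero X) : heartProj t X :=
  ⟨⟨le_of_isZero hX 0, ge_of_isZero hX 0⟩, fun _ f _ => hX.eq_of_src f 0⟩

instance : (heartProj t).ContainsZero := ⟨0, isZero_zero T, heartProj_of_isZero (isZero_zero T)⟩

lemma heart_shift_le_le (b : ℤ) : t.heart.shift b ≤ t.le b :=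
  (shift_mono (Q := t.le 0) (fun _ h => h.1) b).trans_eq (t.shift_le b 0 b (add_zero b))

lemma heart_shift_le_ge (b : ℤ) : t.heart.shift b ≤ t.ge b :=
  (shift_mono (Q := t.ge 0) (fun _ h => h.2) b).trans_eq (t.shift_ge b 0 b (add_zero b))

lemma heart_extensionProduct_heart : t.heart ∗ t.heart ≤ t.heart := fun X hX =>
  ⟨le_extensionProduct_le 0 X (extensionProduct_mono (fun _ h => h.1) (fun _ h => h.1) X hX),
   ge_extensionProduct_ge 0 X (extensionProduct_mono (fun _ h => h.2) (fun _ h => h.2) X hX)⟩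

lemma homZero_heartProj_le {j m : ℤ} (h : m < j) : HomZero ((heartProj t).shift j) (t.le m) := by
  have h1 : HomZero (heartProj t) (t.le (-1)) := fun _ hX => hX.2
  refine (h1.shift j).mono le_rfl ?_
  rw [t.shift_le j (-1) (j + -1) rfl]
  exact t.le_monotone (by lia)

lemma shift_shift_eq (P : ObjectProperty T) [P.IsClosedUnderIsomorphisms] {a b c : ℤ}
    (h : a + b = c) : (P.shift b).shift a = P.shift c := P.shift_shift a b c h

variable (t) in
instance isResolving_heartProj : IsResolving t (heartProj t) where
  heartProj_le := le_rfl
  le_heart _ h := h.1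
  homZero k hk := by
    have := homZero_heartProj_le (t := t) (j := 0) (m := k) hk
    rw [shift_zero] at this
    exact this.mono le_rfl ((shift_mono (fun _ h => h.1) k).trans (heart_shift_le_le k))
  le_cosyzygy := by
    have : ((heartProj t).shift (1 : ℤ)).ContainsZero :=
      ⟨0, isZero_zero T, heartProj_of_isZero (Functor.map_isZero _ (isZero_zero T))⟩
    exact le_extensionProduct_right _
  extension_le X hX := ⟨heart_extensionProduct_heart X
      (extensionProduct_mono (fun _ h => h.1) (fun _ h => h.1) X hX),
    extensionProduct_le_of_isTriangulatedClosed₂ (fun _ h => h.2) (fun _ h => h.2) X hX⟩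
  kernel_le X hX := by
    refine ⟨⟨hX.2, ge_extensionProduct_ge 0 X (extensionProduct_mono ?_ ?_ X hX.1)⟩, ?_⟩
    · exact ((shift_mono (fun _ h => h.1) 1).trans (heart_shift_le_ge 1)).trans
        (t.ge_antitone (by lia))
    · exact fun _ h => h.1.2
    · refine extensionProduct_le_of_isTriangulatedClosed₂ ?_ (fun _ h => h.2) X hX.1
      exact homZero_heartProj_le (by lia)

end Resolving

/-! ### Complexes of objects of the heart as iterated extensions -/

section Tower

variable {T : Type u} [Category.{v} T] [Preadditive T] [HasZeroObject T] [HasShift T ℤ]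
  [∀ n : ℤ, (shiftFunctor T n).Additive] [Pretriangulated T]

/-- The iterated extensions `P[-b] ∗ P[-(b-1)] ∗ ⋯ ∗ P[-(b-n+1)]`. For a class `P` of objects of
the heart these are the objects that are represented by complexes of objects of `P` in the `n`
degrees `b-n+1, …, b`; note that `P.shift b` consists of the objects of `P` placed in degree `b`. -/
def tower (P : ObjectProperty T) : ℤ → ℕ → ObjectProperty T
  | _, 0 => fun M => IsZero M
  | b, n + 1 => P.shift b ∗ tower P (b - 1) n

variable (P : ObjectProperty T)

lemma tower_succ (b : ℤ) (n : ℕ) : tower P b (n + 1) = P.shift b ∗ tower P (b - 1) n := rfl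

instance (b : ℤ) (n : ℕ) : (tower P b n).IsClosedUnderIsomorphisms := by
  cases n with
  | zero => exact ⟨fun e h => h.of_iso e.symm⟩
  | succ n => rw [tower_succ]; infer_instance

variable {P} in
lemma tower_mono {Q : ObjectProperty T} (h : P ≤ Q) (b : ℤ) (n : ℕ) :
    tower P b n ≤ tower Q b n := by
  induction n generalizing b with
  | zero => exact le_rfl
  | succ n ih => exact extensionProduct_mono (shift_mono h b) (ih _)

instance [P.ContainsZero] [P.IsClosedUnderIsomorphisms] (n : ℤ) : (P.shift n).ContainsZero :=
  ⟨0, isZero_zero T, P.prop_of_isZero (Functor.map_isZero _ (isZero_zero T))⟩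

lemma tower_shift [P.IsClosedUnderIsomorphisms] (b k b' : ℤ) (h : k + b = b') (n : ℕ) :
    (tower P b n).shift k = tower P b' n := by
  induction n generalizing b b' with
  | zero =>
    ext X
    refine ⟨fun hX => ?_, fun hX => Functor.map_isZero (shiftFunctor T k) hX⟩
    exact (Functor.map_isZero (shiftFunctor T (-k)) hX).of_iso
      ((shiftFunctorCompIsoId T k (-k) (add_neg_cancel k)).symm.app X)
  | succ n ih =>
    rw [tower_succ, tower_succ, extensionProduct_shift, ih (b - 1) (b' - 1) (by lia),
      shift_shift_eq P h]

lemma tower_one [P.IsClosedUnderIsomorphisms] (b : ℤ) : tower P b 1 = P.shift b := by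
  refine le_antisymm (extensionProduct_le_of_isZero_right fun _ h => h) fun X hX => ?_
  exact ⟨X, 0, 𝟙 X, 0, 0, contractible_distinguished X, hX, isZero_zero T⟩

lemma tower_add [IsTriangulated T] [P.IsClosedUnderIsomorphisms] (b : ℤ) (m n : ℕ) :
    tower P b (m + n) = tower P b m ∗ tower P (b - m) n := by
  induction m generalizing b with
  | zero =>
    simp only [zero_add, Nat.cast_zero, sub_zero]
    refine le_antisymm ?_ (extensionProduct_le_of_isZero_left fun _ h => h)
    have : (tower P b 0).ContainsZero := ⟨0, isZero_zero T, isZero_zero T⟩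
    exact le_extensionProduct_right _
  | succ m ih =>
    rw [Nat.succ_add, tower_succ, tower_succ, ih, extensionProduct_assoc,
      show b - 1 - (m : ℤ) = b - ((m + 1 : ℕ) : ℤ) by push_cast; ring]

lemma tower_succ' [IsTriangulated T] [P.IsClosedUnderIsomorphisms] (b : ℤ) (n : ℕ) :
    tower P b (n + 1) = tower P b n ∗ P.shift (b - n) := by
  rw [tower_add, tower_one]

section

variable [P.ContainsZero] [P.IsClosedUnderIsomorphisms]

instance (b : ℤ) (n : ℕ) : (tower P b n).ContainsZero := by
  induction n generalizing b with
  | zero => exact ⟨0, isZero_zero T, isZero_zero T⟩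
  | succ n ih =>
    have := ih (b - 1)
    obtain ⟨Z, hZ, h⟩ := (tower P (b - 1) n).exists_prop_of_containsZero
    exact ⟨Z, hZ, le_extensionProduct_right (P.shift b) Z h⟩

lemma tower_le_add [IsTriangulated T] (b : ℤ) (m n : ℕ) : tower P b m ≤ tower P b (m + n) := by
  rw [tower_add]
  exact le_extensionProduct_left _

/-- A tower may be enlarged by zero objects at both ends. -/
lemma tower_le_tower [IsTriangulated T] {b b' : ℤ} {n n' : ℕ} (h : b ≤ b')
    (h' : b' - n' ≤ b - n) : tower P b n ≤ tower P b' n' := by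
  obtain ⟨k, rfl⟩ := Int.le.dest h
  have h1 : tower P b n ≤ tower P (b + k) (k + n) := by
    rw [tower_add, add_sub_cancel_right]
    exact le_extensionProduct_right _
  obtain ⟨l, rfl⟩ : ∃ l, n' = k + n + l := ⟨n' - (k + n), by lia⟩
  exact h1.trans (tower_le_add P _ _ _)

end

lemma tower_biprod [P.IsClosedUnderIsomorphisms] (hP : ∀ X Y, P X → P Y → P (X ⊞ Y)) (b : ℤ)
    (n : ℕ) {X Y : T} (hX : tower P b n X) (hY : tower P b n Y) : tower P b n (X ⊞ Y) := by
  induction n generalizing b X Y with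
  | zero => exact IsZero.of_iso (isZero_zero T) ⟨0, 0, by
      ext <;> simp [hX.eq_of_src biprod.inl 0, hY.eq_of_src biprod.inr 0], by simp⟩
  | succ n ih =>
    obtain ⟨A, B, f, g, h, hT, hA, hB⟩ := hX
    obtain ⟨A', B', f', g', h', hT', hA', hB'⟩ := hY
    obtain ⟨_, _, _, hT''⟩ := exists_distTriang_biprod hT hT'
    refine ⟨_, _, _, _, _, hT'', ?_, ih _ hB hB'⟩
    have : PreservesBinaryBiproduct A A' (shiftFunctor T b) :=
      preservesBinaryBiproduct_of_preservesBiproduct _ _ _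
    exact P.prop_of_iso ((shiftFunctor T b).mapBiprod A A').symm (hP _ _ hA hA')

variable {P} {t : TStructure T}

lemma tower_le_le (hP : P ≤ t.heart) (b : ℤ) (n : ℕ) : tower P b n ≤ t.le b := by
  induction n generalizing b with
  | zero => exact fun X hX => le_of_isZero hX b
  | succ n ih =>
    refine (extensionProduct_mono ?_ ?_).trans (le_extensionProduct_le b)
    · exact (shift_mono hP b).trans (heart_shift_le_le b)
    · exact (ih _).trans (t.le_monotone (by lia))

lemma tower_le_ge (hP : P ≤ t.heart) {b c : ℤ} {n : ℕ} (hc : c ≤ b - n + 1) :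
    tower P b n ≤ t.ge c := by
  induction n generalizing b with
  | zero => exact fun X hX => ge_of_isZero hX c
  | succ n ih =>
    refine (extensionProduct_mono ?_ (ih (by lia))).trans (ge_extensionProduct_ge c)
    exact ((shift_mono hP b).trans (heart_shift_le_ge b)).trans (t.ge_antitone (by lia))

lemma homZero_tower_right {Q : ObjectProperty T} {b : ℤ} {n : ℕ}
    (h : ∀ j, b - n < j → j ≤ b → HomZero Q (P.shift j)) : HomZero Q (tower P b n) := by
  induction n generalizing b with
  | zero => exact fun X _ Y f hY => hY.eq_of_tgt f 0
  | succ n ih =>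
    refine HomZero.extensionProduct_right (h b (by lia) le_rfl) (ih fun j hj hj' => ?_)
    exact h j (by lia) (by lia)

end Tower

/-! ### Bounded complexes of objects of a resolving class -/

section ResolvingTower

variable {T : Type u} [Category.{v} T] [Preadditive T] [HasZeroObject T] [HasShift T ℤ]
  [∀ n : ℤ, (shiftFunctor T n).Additive] [Pretriangulated T]
  {t : TStructure T} {G : ObjectProperty T}

lemma IsResolving.biprod (hG : IsResolving t G) {X Y : T} (hX : G X) (hY : G Y) : G (X ⊞ Y) :=
  hG.extension_le _ (extensionProduct_biprod hX hY)

lemma IsResolving.containsZero (hG : IsResolving t G) : G.ContainsZero :=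
  ⟨0, isZero_zero T, hG.heartProj_le _ (heartProj_of_isZero (isZero_zero T))⟩

lemma shift_extensionProduct_le (hG : IsResolving t G) (b : ℤ) :
    G.shift b ∗ G.shift b ≤ G.shift b :=
  (extensionProduct_shift_le G G b).trans (shift_mono hG.extension_le b)

lemma homZero_shift (hG : IsResolving t G) {j k : ℤ} (h : k < j) :
    HomZero (G.shift j) ((heartProj t).shift k) := by
  have := (hG.homZero (k - j) (by lia)).shift j
  rwa [shift_shift_eq _ (show j + (k - j) = k by lia)] at this

variable [IsTriangulated T]

/-- If the cohomology in degree `b` of a complex of objects of `G` in degrees `≤ b` vanishes, its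
terms of degrees `b` and `b - 1` may be replaced by the kernel of the epimorphism between them,
which is in `G`. -/
lemma tower_of_le_pred (hG : IsResolving t G) {b : ℤ} {n : ℕ} {M : T}
    (hM : tower G b (n + 1) M) (hM' : t.le (b - 1) M) : tower G (b - 1) n M := by
  cases n with
  | zero =>
    rw [tower_one] at hM
    exact isZero_of_le_of_ge (b := b) (by lia) hM'
      (heart_shift_le_ge b _ (hG.le_heart _ hM))
  | succ n =>
    rw [tower_succ, tower_succ, ← extensionProduct_assoc] at hM
    obtain ⟨F, N, f, g, h, hT, hF, hN⟩ := hM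
    refine ⟨F, N, f, g, h, hT, ?_, hN⟩
    have hF' : t.le (b - 1) F := by
      refine le_extensionProduct_le (b - 1) F
        ⟨_, _, _, _, _, inv_rot_of_distTriang _ hT, ?_, hM'⟩
      refine t.le_shift (b - 2) (-1) (b - 1) (by lia) N ?_
      exact tower_le_le hG.le_heart _ _ _ (by rwa [show b - 2 = b - 1 - 1 by lia])
    refine hG.kernel_le _ ⟨?_, t.le_shift (b - 1) (b - 1) 0 (by lia) F hF'⟩
    have h1 := extensionProduct_shift (G.shift (1 : ℤ)) G (b - 1)
    rw [shift_shift_eq G (show b - 1 + 1 = b by lia)] at h1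
    exact h1.ge _ hF

/-- A complex of objects of `G` may be truncated above its cohomology. -/
lemma tower_of_le (hG : IsResolving t G) {s : ℤ} (k : ℕ) {n : ℕ} {M : T}
    (hM : tower G (s + k) (n + k) M) (hM' : t.le s M) : tower G s n M := by
  induction k with
  | zero => simpa using hM
  | succ k ih =>
    refine ih ?_
    have := tower_of_le_pred (n := n + k) hG hM (t.le_monotone (by push_cast; lia) _ hM')
    rwa [show s + ((k + 1 : ℕ) : ℤ) - 1 = s + k by push_cast; ring] at this

/-- Extending by a projective object in a degree of the tower leaves the tower: the projective
object is moved past the objects of lower degrees and is absorbed by the object of its degree. -/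
lemma tower_extensionProduct_heartProj_le (hG : IsResolving t G) {b j : ℤ} {n : ℕ}
    (hj : b - n < j) (hj' : j ≤ b) : tower G b n ∗ (heartProj t).shift j ≤ tower G b n := by
  induction n generalizing b with
  | zero => lia
  | succ n ih =>
    rw [tower_succ, extensionProduct_assoc]
    obtain rfl | hj'' := hj'.eq_or_lt
    · have h : tower G (j - 1) n ∗ (heartProj t).shift j ≤
          (heartProj t).shift j ∗ tower G (j - 1) n := by
        refine extensionProduct_swap fun X Y hX hY f => ?_
        refine (homZero_heartProj_le (by lia : j - 1 - 1 < j)).eq_zero hY ?_ f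
        exact t.le_shift _ _ _ (by lia) _ (tower_le_le hG.le_heart _ _ _ hX)
      refine (extensionProduct_mono le_rfl h).trans ?_
      rw [← extensionProduct_assoc]
      refine extensionProduct_mono ?_ le_rfl
      exact (extensionProduct_mono le_rfl (shift_mono hG.heartProj_le j)).trans
        (shift_extensionProduct_le hG j)
    · exact extensionProduct_mono le_rfl (ih (by lia) (by lia))

lemma tower_extensionProduct_tower_heartProj_le (hG : IsResolving t G) {b b' : ℤ} {n n' : ℕ}
    (hb : b' ≤ b) (hn : b - n ≤ b' - n') :
    tower G b n ∗ tower (heartProj t) b' n' ≤ tower G b n := by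
  induction n' generalizing b' with
  | zero => exact extensionProduct_le_of_isZero_right fun _ h => h
  | succ n' ih =>
    rw [tower_succ, ← extensionProduct_assoc]
    refine (extensionProduct_mono ?_ le_rfl).trans (ih (b' := b' - 1) (by lia) (by lia))
    exact tower_extensionProduct_heartProj_le hG (by lia) hb

/-- The assumption that the heart has enough projective objects: each object that is `≤ 0` is the
target of a morphism from a projective object of the heart whose cone is `≤ -1`. -/
def EnoughProj (t : TStructure T) : Prop := t.le 0 ≤ heartProj t ∗ t.le (-1)

lemma le_le_tower_extensionProduct_le (ht : EnoughProj t) (s : ℤ) (n : ℕ) :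
    t.le s ≤ tower (heartProj t) s n ∗ t.le (s - n) := by
  induction n generalizing s with
  | zero =>
    have : (tower (heartProj t) s 0).ContainsZero := ⟨0, isZero_zero T, isZero_zero T⟩
    simpa using le_extensionProduct_right (Q := t.le s) (tower (heartProj t) s 0)
  | succ n ih =>
    have h := shift_mono ht s
    rw [extensionProduct_shift, t.shift_le s 0 s (add_zero s), t.shift_le s (-1) (s - 1) rfl] at h
    rw [tower_succ, extensionProduct_assoc]
    refine h.trans (extensionProduct_mono le_rfl ((ih (s - 1)).trans_eq ?_))
    rw [show s - 1 - (n : ℤ) = s - ((n + 1 : ℕ) : ℤ) by push_cast; ring]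

/-- The syzygies of a complex of objects of `G` are in `G`: they do not depend on the projective
resolution by which they are computed. -/
lemma shift_of_tower_of_distTriang (hG : IsResolving t G) {s : ℤ} {n : ℕ} {Y M N : T} {f : Y ⟶ M}
    {g : M ⟶ N} {h : N ⟶ Y⟦(1 : ℤ)⟧} (hT : Triangle.mk f g h ∈ distTriang T)
    (hY : tower (heartProj t) s n Y) (hM : tower G s (n + 1) M) (hN : t.le (s - n) N) :
    G.shift (s - n) N := by
  have hY' : tower (heartProj t) (s - 1) n (Y⟦(1 : ℤ)⟧) := by
    rwa [← tower_shift (heartProj t) (s - 1) 1 s (by lia) n] at hY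
  rw [← tower_one]
  refine tower_of_le hG n ?_ hN
  rw [sub_add_cancel, add_comm 1 n]
  refine tower_extensionProduct_tower_heartProj_le hG (b' := s - 1) (n' := n) (by lia)
    (by push_cast; lia) _ ?_
  exact ⟨_, _, _, _, _, rot_of_distTriang _ hT, hM, hY'⟩

/-- The class of objects represented by complexes of objects of `G` in given degrees is closed
under direct summands. -/
lemma tower_isStableUnderRetracts (ht : EnoughProj t) (hG : IsResolving t G) (s : ℤ) (n : ℕ) :
    (tower G s n).IsStableUnderRetracts where
  of_retract {M M₀} r hM₀ := by
    cases n with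
    | zero => exact (IsZero.iff_id_eq_zero _).2 (by
        rw [← r.retract, IsZero.eq_of_tgt hM₀ r.i 0, zero_comp])
    | succ n =>
      obtain ⟨M', _, _, hM'⟩ := distinguished_cocone_triangle r.i
      obtain ⟨e⟩ := nonempty_iso_biprod_of_retract r hM'
      have hs := tower_le_le hG.le_heart _ _ _ hM₀
      have r' : Retract M' M₀ :=
        { i := biprod.inr ≫ e.inv
          r := e.hom ≫ biprod.snd }
      obtain ⟨Y, N, f, g, h, hT, hY, hN⟩ :=
        le_le_tower_extensionProduct_le ht s n M ((t.le s).prop_of_retract r hs)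
      obtain ⟨Y', N', f', g', h', hT', hY', hN'⟩ :=
        le_le_tower_extensionProduct_le ht s n M' ((t.le s).prop_of_retract r' hs)
      obtain ⟨_, _, _, hT''⟩ := exists_distTriang_biprod hT hT'
      have hN'' : G.shift (s - n) (N ⊞ N') :=
        shift_of_tower_of_distTriang hG hT''
          (tower_biprod _ (fun _ _ => (isResolving_heartProj t).biprod) s n hY hY')
          ((tower G s (n + 1)).prop_of_iso e hM₀)
          (le_extensionProduct_le _ _ (extensionProduct_biprod hN hN'))
      rw [tower_succ']
      refine ⟨_, _, _, _, _, hT, tower_mono hG.heartProj_le _ _ _ hY, ?_⟩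
      have r'' : Retract N (N ⊞ N') := { i := biprod.inl, r := biprod.fst }
      exact G.prop_of_retract (r''.map (shiftFunctor T (s - n))) hN''

/-- A complex of objects of `G` may be replaced by one whose terms, except for the term of highest
degree, are projective. -/
lemma tower_succ_le (hG : IsResolving t G) (b : ℤ) (n : ℕ) :
    tower G b (n + 1) ≤ G.shift b ∗ tower (heartProj t) (b - 1) n := by
  induction n generalizing b with
  | zero =>
    rw [tower_succ]
    exact extensionProduct_mono le_rfl le_rfl
  | succ n ih =>
    have h1 : G.shift (b - 1) ≤ G.shift b ∗ (heartProj t).shift (b - 1) := by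
      have := shift_mono hG.le_cosyzygy (b - 1)
      rwa [extensionProduct_shift, shift_shift_eq G (show b - 1 + 1 = b by lia)] at this
    rw [tower_succ, tower_succ]
    refine (extensionProduct_mono le_rfl (ih (b - 1))).trans ?_
    refine (extensionProduct_mono le_rfl (extensionProduct_mono h1 le_rfl)).trans ?_
    rw [extensionProduct_assoc, ← extensionProduct_assoc]
    exact extensionProduct_mono (shift_extensionProduct_le hG b) le_rfl

lemma tower_succ_add_le (hG : IsResolving t G) (b : ℤ) (m n : ℕ) :
    tower G b (m + 1 + n) ≤ tower G b (m + 1) ∗ tower (heartProj t) (b - m - 1) n := by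
  rw [add_assoc, add_comm 1 n, tower_add, tower_succ' G b m, extensionProduct_assoc]
  exact extensionProduct_mono le_rfl (tower_succ_le hG _ _)

/-- The objects represented by a bounded complex of objects of `G`. -/
def boundedTower (G : ObjectProperty T) : ObjectProperty T := fun M => ∃ s n, tower G s n M

lemma tower_of_boundedTower (hG : IsResolving t G) {M : T} (hM : boundedTower G M) {s : ℤ}
    (hs : t.le s M) : ∃ n, tower G s n M := by
  have := hG.containsZero
  obtain ⟨s', n, hM⟩ := hM
  obtain h | h := le_total s' s
  · obtain ⟨k, rfl⟩ := Int.le.dest h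
    exact ⟨n + k, tower_le_tower G h (by push_cast; lia) _ hM⟩
  · obtain ⟨k, rfl⟩ := Int.le.dest h
    exact ⟨n, tower_of_le hG k (tower_le_add G _ _ _ _ hM) hs⟩

lemma boundedTower_isStableUnderRetracts (ht : EnoughProj t) (hG : IsResolving t G) :
    (boundedTower G).IsStableUnderRetracts where
  of_retract := by
    rintro M M₀ r ⟨s, n, h⟩
    have := tower_isStableUnderRetracts ht hG s n
    exact ⟨s, n, (tower G s n).prop_of_retract r h⟩

/-- An extension of two bounded complexes of objects of `G` is such a complex: the quotient is
replaced by a projective resolution that ends with a syzygy of sufficiently low degree. -/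
lemma boundedTower_isTriangulated (ht : EnoughProj t) (hG : IsResolving t G) :
    (boundedTower G).IsTriangulated := by
  have := hG.containsZero
  have : (boundedTower G).IsClosedUnderIsomorphisms :=
    ⟨fun e ⟨s, n, h⟩ => ⟨s, n, (tower G s n).prop_of_iso e h⟩⟩
  have h₂ : (boundedTower G).IsTriangulatedClosed₂ := .mk' fun Tr hTr h₁ h₃ => by
    obtain ⟨s₁, n₁, h₁⟩ := h₁
    obtain ⟨s₃, n₃, h₃⟩ := h₃
    let s := max s₁ s₃
    let n := (s - min (s₁ - n₁) (s₃ - n₃)).toNat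
    replace h₁ : tower G s n Tr.obj₁ := tower_le_tower G (by lia) (by lia) _ h₁
    replace h₃ : tower G s (n + 1) Tr.obj₃ := tower_le_tower G (by lia) (by lia) _ h₃
    obtain ⟨Y, N, f, g, h, hT, hY, hN⟩ :=
      le_le_tower_extensionProduct_le ht s n _ (tower_le_le hG.le_heart _ _ _ h₃)
    have hN' := shift_of_tower_of_distTriang hG hT hY h₃ hN
    refine ⟨s, n + 1, ?_⟩
    rw [tower_succ']
    have h4 : (tower G s n ∗ (tower (heartProj t) s n ∗ G.shift (s - n))) Tr.obj₂ :=
      ⟨_, _, _, _, _, hTr, h₁, ⟨_, _, _, _, _, hT, hY, hN'⟩⟩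
    rw [← extensionProduct_assoc] at h4
    refine extensionProduct_mono ?_ le_rfl _ h4
    exact tower_extensionProduct_tower_heartProj_le hG le_rfl le_rfl
  exact
    { h₂ with
      exists_zero := ⟨0, isZero_zero T, 0, 0, isZero_zero T⟩
      isStableUnderShiftBy := fun a => ⟨fun X ⟨s, n, h⟩ => ⟨s - a, n, by
        rwa [← tower_shift G (s - a) a s (by lia) n] at h⟩⟩ }

end ResolvingTower

/-! ### Ghosts and levels -/

section Thick

variable {T : Type u} [Category.{v} T] [Preadditive T] [HasZeroObject T] [HasShift T ℤ]
  [∀ n : ℤ, (shiftFunctor T n).Additive] [Pretriangulated T]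

lemma addClosure_mono {P Q : ObjectProperty T} (h : P ≤ Q) : addClosure P ≤ addClosure Q := by
  rintro M ⟨n, f, b, N, hf, hb, e⟩
  exact ⟨n, f, b, N, fun i => h _ (hf i), hb, e⟩

lemma angle_mono {P Q : ObjectProperty T} (h : P ≤ Q) : angle P ≤ angle Q :=
  addClosure_mono (monotone_shiftClosure h)

lemma angleIter_mono {P Q : ObjectProperty T} (h : P ≤ Q) (r : ℕ) :
    angleIter P r ≤ angleIter Q r := by
  induction r with
  | zero => exact le_rfl
  | succ r ih =>
    cases r with
    | zero => exact angle_mono h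
    | succ r => exact angle_mono (extensionProduct_mono ih (angle_mono h))

lemma angle_le {P Q : ObjectProperty T} [Q.IsStableUnderRetracts] [Q.IsTriangulated]
    (h : P ≤ Q) : angle P ≤ Q := by
  rintro M ⟨n, f, b, N, hf, ⟨hb⟩, ⟨e⟩⟩
  have hb' : Q b.pt := by
    refine Q.prop_of_isLimit_fan hb.isLimit fun j => ?_
    obtain ⟨Y, a, i, hY⟩ := hf j
    exact Q.prop_of_iso i.symm (Q.le_shift a _ (h _ hY))
  exact Q.prop_of_retract { i := biprod.inl ≫ e.hom, r := e.inv ≫ biprod.fst } hb'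

lemma angleIter_le {P Q : ObjectProperty T} [Q.IsStableUnderRetracts] [Q.IsTriangulated]
    (h : P ≤ Q) (r : ℕ) : angleIter P r ≤ Q := by
  induction r with
  | zero => exact fun M hM => Q.prop_of_isZero hM
  | succ r ih =>
    cases r with
    | zero => exact angle_le h
    | succ r => exact angle_le (extensionProduct_le_of_isTriangulatedClosed₂ ih (angle_le h))

end Thick

section Ghost

variable {T : Type u} [Category.{v} T] [Preadditive T] [HasZeroObject T] [HasShift T ℤ]
  [∀ n : ℤ, (shiftFunctor T n).Additive] [Pretriangulated T] (G : ObjectProperty T)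

/-- A `G`-ghost is a morphism that becomes zero after composition with each morphism from a shift
of an object of `G`. -/
def IsGhost {X Y : T} (f : X ⟶ Y) : Prop :=
  ∀ (A : T) (k : ℤ), G.shift k A → ∀ g : A ⟶ X, g ≫ f = 0

/-- The compositions of `r` consecutive `G`-ghosts (preceded by an arbitrary morphism, which makes
no difference for `r > 0`). -/
def IsGhostComp : ℕ → ∀ {X Y : T}, (X ⟶ Y) → Prop
  | 0, _, _, _ => True
  | r + 1, X, Y, f => ∃ (Z : T) (g : X ⟶ Z) (h : Z ⟶ Y), IsGhostComp r g ∧ IsGhost G h ∧ f = g ≫ h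

variable {G}

lemma IsGhost.shift [G.IsClosedUnderIsomorphisms] {X Y : T} {f : X ⟶ Y} (hf : IsGhost G f)
    (a : ℤ) : IsGhost G (f⟦a⟧') := by
  intro A k hA g
  let e := shiftFunctorCompIsoId T a (-a) (add_neg_cancel a)
  have hA' : G.shift (a + k) (A⟦-a⟧) :=
    G.prop_of_iso ((shiftFunctorAdd' T (-a) (a + k) k (by lia)).app A) hA
  have h := hf _ _ hA' (g⟦-a⟧' ≫ e.hom.app X)
  have hn : f⟦a⟧'⟦-a⟧' ≫ e.hom.app Y = e.hom.app X ≫ f := e.hom.naturality f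
  refine (shiftFunctor T (-a)).map_injective ((cancel_mono (e.hom.app Y)).1 ?_)
  rw [Functor.map_comp, Category.assoc, hn, Functor.map_zero, zero_comp, ← h, Category.assoc]

lemma IsGhostComp.shift [G.IsClosedUnderIsomorphisms] {r : ℕ} {X Y : T} {f : X ⟶ Y}
    (hf : IsGhostComp G r f) (a : ℤ) : IsGhostComp G r (f⟦a⟧') := by
  induction r generalizing X Y with
  | zero => trivial
  | succ r ih =>
    obtain ⟨Z, g, h, hg, hh, rfl⟩ := hf
    exact ⟨_, _, _, ih hg, hh.shift a, Functor.map_comp _ _ _⟩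

lemma IsGhostComp.comp_left {r : ℕ} {W X Y : T} {f : X ⟶ Y} (hf : IsGhostComp G r f) (e : W ⟶ X) :
    IsGhostComp G r (e ≫ f) := by
  induction r generalizing X Y with
  | zero => trivial
  | succ r ih =>
    obtain ⟨Z, g, h, hg, hh, rfl⟩ := hf
    exact ⟨_, _, _, ih hg e, hh, (Category.assoc _ _ _).symm⟩

variable (G) in
/-- The objects on which all compositions of `r` consecutive `G`-ghosts vanish. -/
def ghostKernel (r : ℕ) : ObjectProperty T :=
  fun M => ∀ ⦃Y : T⦄ (f : M ⟶ Y), IsGhostComp G r f → f = 0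

/-- The vanishing of compositions of ghosts passes to shifts, finite direct sums and summands. -/
lemma angle_le_ghostKernel [G.IsClosedUnderIsomorphisms] {P : ObjectProperty T} {r : ℕ}
    (h : P ≤ ghostKernel G r) : angle P ≤ ghostKernel G r := by
  rintro M ⟨n, F, b, N, hF, ⟨hb⟩, ⟨e⟩⟩ Y f hf
  have h1 : e.inv ≫ biprod.fst ≫ f = 0 := by
    refine hb.isColimit.hom_ext fun ⟨j⟩ => ?_
    change b.ι j ≫ e.inv ≫ biprod.fst ≫ f = b.ι j ≫ 0
    rw [comp_zero]
    obtain ⟨A, a, i, hA⟩ := hF j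
    refine (cancel_epi i.inv).1 ?_
    rw [comp_zero]
    refine (shiftFunctor T (-a)).map_injective ?_
    refine (cancel_epi ((shiftFunctorCompIsoId T a (-a) (add_neg_cancel a)).inv.app A)).1 ?_
    rw [Functor.map_zero, comp_zero]
    exact h A hA _ ((((hf.comp_left _).comp_left _).comp_left _).comp_left _ |>.shift _
      |>.comp_left _)
  have h2 : f = biprod.inl ≫ e.hom ≫ e.inv ≫ biprod.fst ≫ f := by simp
  rw [h2, h1, comp_zero, comp_zero]

/-- The arbitrary morphism in the definition of `IsGhostComp` may be moved to the end. -/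
lemma IsGhostComp.exists_isGhost {r : ℕ} {X Y : T} {f : X ⟶ Y} (hf : IsGhostComp G (r + 1) f) :
    ∃ (Z : T) (g : X ⟶ Z) (h : Z ⟶ Y), IsGhost G g ∧ IsGhostComp G r h ∧ f = g ≫ h := by
  induction r generalizing Y with
  | zero =>
    obtain ⟨Z, g, h, -, hh, rfl⟩ := hf
    refine ⟨Y, g ≫ h, 𝟙 Y, fun A k hA a => ?_, trivial, (Category.comp_id _).symm⟩
    rw [← Category.assoc, hh A k hA]
  | succ r ih =>
    obtain ⟨Z, g, h, hg, hh, rfl⟩ := hf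
    obtain ⟨W, a, b, ha, hb, rfl⟩ := ih hg
    exact ⟨W, a, b ≫ h, ha, ⟨Z, b, h, hb, hh, rfl⟩, Category.assoc _ _ _⟩

lemma angle_le_ghostKernel_one [G.IsClosedUnderIsomorphisms] : angle G ≤ ghostKernel G 1 := by
  refine angle_le_ghostKernel fun M hM Y f hf => ?_
  obtain ⟨Z, g, h, -, hh, rfl⟩ := hf
  exact hh M 0 (G.prop_of_iso ((shiftFunctorZero T ℤ).symm.app M) hM) g

lemma ghostKernel_one_eq_zero {M Y : T} (hM : ghostKernel G 1 M) {f : M ⟶ Y} (hf : IsGhost G f) :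
    f = 0 :=
  hM f ⟨M, 𝟙 M, f, trivial, hf, (Category.id_comp f).symm⟩

lemma extensionProduct_one_le_ghostKernel (r : ℕ) :
    ghostKernel G r ∗ ghostKernel G 1 ≤ ghostKernel G (r + 1) := by
  rintro M ⟨A, B, i, p, δ, hT, hA, hB⟩ Y f ⟨Z, g, h, hg, hh, rfl⟩
  obtain ⟨q, hq⟩ : ∃ q : B ⟶ Z, g = p ≫ q :=
    Triangle.yoneda_exact₂ _ hT g (hA _ (hg.comp_left i))
  have : q ≫ h = 0 := hB _ ⟨Z, q, h, trivial, hh, rfl⟩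
  rw [hq, Category.assoc, this, comp_zero]

/-- The variant of `extensionProduct_one_le_ghostKernel` with the factors exchanged, which serves
for levels in the opposite category. -/
lemma one_extensionProduct_le_ghostKernel [G.IsClosedUnderIsomorphisms] (r : ℕ) :
    ghostKernel G 1 ∗ ghostKernel G r ≤ ghostKernel G (r + 1) := by
  rintro M ⟨A, B, i, p, δ, hT, hA, hB⟩ Y f hf
  obtain ⟨Z, g, h, hg, hh, rfl⟩ := hf.exists_isGhost
  have hig : i ≫ g = 0 := ghostKernel_one_eq_zero hA fun C k hC a => by
    rw [← Category.assoc]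
    exact hg C k hC _
  obtain ⟨q, hq⟩ : ∃ q : B ⟶ Z, g = p ≫ q := Triangle.yoneda_exact₂ _ hT g hig
  have : q ≫ h = 0 := hB _ (hh.comp_left q)
  rw [hq, Category.assoc, this, comp_zero]

/-- The ghost lemma: a composition of `r` ghosts vanishes on the objects of level at most `r`. -/
lemma angleIter_le_ghostKernel [G.IsClosedUnderIsomorphisms] (r : ℕ) :
    angleIter G r ≤ ghostKernel G r := by
  induction r with
  | zero => exact fun M hM Y f _ => IsZero.eq_of_src hM f 0
  | succ r ih =>
    cases r with
    | zero => exact angle_le_ghostKernel_one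
    | succ r =>
      exact angle_le_ghostKernel ((extensionProduct_mono ih angle_le_ghostKernel_one).trans
        (extensionProduct_one_le_ghostKernel _))

end Ghost

section LevelBound

variable {T : Type u} [Category.{v} T] [Preadditive T] [HasZeroObject T] [HasShift T ℤ]
  [∀ n : ℤ, (shiftFunctor T n).Additive] [Pretriangulated T] [IsTriangulated T]
  {t : TStructure T} {G : ObjectProperty T}

/-- Let `M` be `≥ i` and let `Y ⟶ M ⟶ Z` be its decomposition into the part in degrees `≥ i` and
a complex of projective objects in degrees `≤ i - 1`. Then `M ⟶ Z` is a ghost, because `Z` has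
only cohomology in degree `i - 1`, where that of `M` vanishes. -/
lemma isGhost_of_tower (hG : IsResolving t G) {M Z : T} (g : M ⟶ Z) {i : ℤ} (hM : t.ge i M) {n : ℕ}
    (hZ : tower (heartProj t) (i - 1) n Z) : IsGhost G g := by
  intro A k hA f
  obtain hk | hk := lt_or_ge k i
  · rw [(homZero_le_ge hk).eq_zero (heart_shift_le_le k _ (hG.le_heart _ hA)) hM f, zero_comp]
  · refine HomZero.eq_zero ?_ hA hZ (f ≫ g)
    exact homZero_tower_right fun j _ hj => homZero_shift hG (by lia)

lemma ge_of_distTriang {Y M Z : T} {f : Y ⟶ M} {g : M ⟶ Z} {h : Z ⟶ Y⟦(1 : ℤ)⟧}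
    (hT : Triangle.mk f g h ∈ distTriang T) {i : ℤ} (hY : t.ge i Y) (hM : t.ge i M) :
    t.ge (i - 1) Z :=
  ge_extensionProduct_ge _ _ ⟨_, _, _, _, _, rot_of_distTriang _ hT,
    t.ge_antitone (by lia) _ hM, t.ge_shift i 1 (i - 1) (by lia) _ hY⟩

/-- A bounded complex of objects of `G` with cohomology in degrees `≥ i` admits a composition of
`r + 1` ghosts whose fibre is its brutal truncation in degrees `≥ i - r`. -/
lemma exists_isGhostComp (hG : IsResolving t G) {M : T} {s i : ℤ} (hi : i ≤ s) {n : ℕ}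
    (hM : tower G s n M) (hM' : t.ge i M) (r : ℕ) :
    ∃ (Y Z : T) (f : Y ⟶ M) (g : M ⟶ Z) (h : Z ⟶ Y⟦(1 : ℤ)⟧),
      Triangle.mk f g h ∈ distTriang T ∧ tower G s ((s - i).toNat + 1 + r) Y ∧
        tower (heartProj t) (i - r - 1) n Z ∧ t.ge (i - r - 1) Z ∧ IsGhostComp G (r + 1) g := by
  have := hG.containsZero
  have hP := isResolving_heartProj t
  induction r with
  | zero =>
    have h0 := tower_succ_add_le hG s (s - i).toNat n _ (tower_le_tower G le_rfl (by lia) _ hM)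
    rw [show s - ((s - i).toNat : ℤ) - 1 = i - 1 by lia] at h0
    obtain ⟨Y, Z, f, g, h, hT, hY, hZ⟩ := h0
    refine ⟨Y, Z, f, g, h, hT, hY, by simpa using hZ, ?_, M, 𝟙 M, g, trivial,
      isGhost_of_tower hG g hM' hZ, (Category.id_comp g).symm⟩
    have := ge_of_distTriang hT (tower_le_ge hG.le_heart (by lia) _ hY) hM'
    simpa using this
  | succ r ih =>
    obtain ⟨Y, Z, f, g, h, hT, hY, hZ, hZ', hg⟩ := ih
    have h0 : ((heartProj t).shift (i - r - 1) ∗ tower (heartProj t) (i - r - 1 - 1) n) Z :=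
      tower_succ (heartProj t) _ _ ▸ tower_le_tower _ le_rfl (by lia) _ hZ
    obtain ⟨A, Z', a, b, δ, hT', hA, hZ₂⟩ := h0
    obtain ⟨Y', f', h', hT''⟩ := distinguished_cocone_triangle₁ (g ≫ b)
    let o := someOctahedron' rfl hT hT' hT''
    rw [show i - ((r + 1 : ℕ) : ℤ) - 1 = i - r - 1 - 1 by push_cast; ring]
    refine ⟨Y', Z', f', g ≫ b, h', hT'', ?_, hZ₂, ?_, Z, g, b, hg,
      isGhost_of_tower hG b hZ' hZ₂, rfl⟩
    · rw [← add_assoc, tower_succ']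
      refine ⟨_, _, _, _, _, o.mem, hY, ?_⟩
      rw [show s - (((s - i).toNat + 1 + r : ℕ) : ℤ) = i - r - 1 by push_cast; lia]
      exact hG.heartProj_le _ hA
    · exact ge_of_distTriang hT' (heart_shift_le_ge _ _ hA.1) hZ'

/-- The level bound in terms of ghosts: if all compositions of `r + 1` consecutive ghosts vanish on
a bounded complex `M` of objects of `G` with cohomology in degrees `i, …, s`, then `M` is
represented by a complex of objects of `G` in degrees `i - r, …, s`. -/
theorem tower_of_ghostKernel (ht : EnoughProj t) (hG : IsResolving t G) {M : T} {r : ℕ}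
    (hb : boundedTower G M) (hM : ghostKernel G (r + 1) M) {s i : ℤ} (his : i ≤ s)
    (hs : t.le s M) (hi : t.ge i M) : tower G s ((s - i).toNat + 1 + r) M := by
  obtain ⟨n, hn⟩ := tower_of_boundedTower hG hb hs
  obtain ⟨Y, Z, f, g, h, hT, hY, -, -, hg⟩ := exists_isGhostComp hG his hn hi r
  have hg0 : g = 0 := hM g hg
  obtain ⟨q, hq⟩ : ∃ q : M ⟶ Y, 𝟙 M = q ≫ f :=
    Triangle.coyoneda_exact₂ _ hT (𝟙 M) (show 𝟙 M ≫ g = 0 by rw [hg0, comp_zero])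
  have := tower_isStableUnderRetracts ht hG s ((s - i).toNat + 1 + r)
  exact prop_of_retract _ { i := q, r := f, retract := hq.symm } hY

lemma le_boundedTower [G.IsClosedUnderIsomorphisms] : G ≤ boundedTower G := fun X hX =>
  ⟨0, 1, by rwa [tower_one, shift_zero]⟩

/-- The level bound in terms of levels: an object of level at most `r + 1` with cohomology in
degrees `i, …, s` is represented by a complex of objects of `G` in degrees `i - r, …, s`. -/
theorem tower_of_angleIter (ht : EnoughProj t) (hG : IsResolving t G) {M : T} {r : ℕ}
    (hM : angleIter G (r + 1) M) {s i : ℤ} (his : i ≤ s) (hs : t.le s M) (hi : t.ge i M) :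
    tower G s ((s - i).toNat + 1 + r) M :=
  have := boundedTower_isTriangulated ht hG
  have := boundedTower_isStableUnderRetracts ht hG
  tower_of_ghostKernel ht hG (angleIter_le le_boundedTower _ _ hM)
    (angleIter_le_ghostKernel _ _ hM) his hs hi

end LevelBound

/-! ### Gorenstein projective objects of the heart -/

section Gorenstein

variable {T : Type u} [Category.{v} T] [Preadditive T] [HasZeroObject T] [HasShift T ℤ]
  [∀ n : ℤ, (shiftFunctor T n).Additive] [Pretriangulated T] (t : TStructure T)

/-- The objects of the heart without higher extensions with projective objects of the heart. -/
def heartPerp : ObjectProperty T :=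
  t.heart ⊓ fun M => ∀ k : ℤ, k < 0 → ((heartProj t).shift k).leftOrthogonal M

/-- The Gorenstein projective objects of the heart, defined coinductively: they form the largest
class of objects without higher extensions with projective objects each of which embeds into a
projective object with cokernel in the class. -/
def heartGproj : ObjectProperty T := fun M =>
  ∃ S : ObjectProperty T, S ≤ heartPerp t ∧ S ≤ S.shift (1 : ℤ) ∗ heartProj t ∧ S M

variable {t}

lemma heartGproj_le_heartPerp : heartGproj t ≤ heartPerp t := by
  rintro M ⟨S, h, -, hM⟩
  exact h M hM

lemma heartGproj_le_cosyzygy : heartGproj t ≤ (heartGproj t).shift (1 : ℤ) ∗ heartProj t := by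
  rintro M ⟨S, h, h', hM⟩
  exact extensionProduct_mono (fun X hX => ⟨S, h, h', hX⟩) le_rfl M (h' M hM)

lemma heartProj_le_heartGproj : heartProj t ≤ heartGproj t := fun _ hM =>
  have hP := isResolving_heartProj t
  ⟨heartProj t, fun X hX => ⟨hX.1, fun k hk => hP.homZero k hk X hX⟩, hP.le_cosyzygy, hM⟩

instance : (heartGproj t).ContainsZero :=
  ⟨0, isZero_zero T, heartProj_le_heartGproj _ (heartProj_of_isZero (isZero_zero T))⟩

lemma homZero_heartGproj (k : ℤ) (hk : k < 0) : HomZero (heartGproj t) ((heartProj t).shift k) :=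
  fun M hM => (heartGproj_le_heartPerp M hM).2 k hk

lemma heartGproj_extensionProduct_le [IsTriangulated T] :
    heartGproj t ∗ heartGproj t ≤ heartGproj t := by
  intro M hM
  refine ⟨_, fun X hX => ⟨?_, fun k hk => ?_⟩, ?_, hM⟩
  · exact heart_extensionProduct_heart X
      (extensionProduct_mono (fun Y hY => (heartGproj_le_heartPerp Y hY).1)
        (fun Y hY => (heartGproj_le_heartPerp Y hY).1) X hX)
  · exact (homZero_heartGproj k hk).extensionProduct_left (homZero_heartGproj k hk) X hX
  · have hs : heartProj t ∗ (heartGproj t).shift (1 : ℤ) ≤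
        (heartGproj t).shift (1 : ℤ) ∗ heartProj t := by
      refine extensionProduct_swap fun X Y hX hY f => ?_
      have h := (homZero_heartGproj (t := t) (-2) (by lia)).shift 1
      rw [shift_shift_eq _ (show (1 : ℤ) + -2 = -1 by lia)] at h
      refine h.eq_zero hY ?_ f
      exact (heartProj t).prop_of_iso
        ((shiftFunctorCompIsoId T 1 (-1) (by lia)).symm.app X) hX
    refine (extensionProduct_mono heartGproj_le_cosyzygy heartGproj_le_cosyzygy).trans ?_
    rw [extensionProduct_assoc, ← extensionProduct_assoc (heartProj t)]
    refine (extensionProduct_mono le_rfl (extensionProduct_mono hs le_rfl)).trans ?_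
    rw [extensionProduct_assoc, ← extensionProduct_assoc]
    exact extensionProduct_mono (extensionProduct_shift_le _ _ _)
      (isResolving_heartProj t).extension_le

instance [IsTriangulated T] : (heartGproj t).IsClosedUnderIsomorphisms where
  of_iso e hX := heartGproj_extensionProduct_le _
    ((heartGproj t ∗ heartGproj t).prop_of_iso e (le_extensionProduct_left _ _ hX))

/-- Direct summands of Gorenstein projective objects are Gorenstein projective: if `M ⊞ N` embeds
into the projective object `P` with cokernel `G`, the cokernel `C` of `M ⟶ P` is an extension of
`G` by `N`, hence `C ⊞ M` is an extension of `G` by `N ⊞ M`. -/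
instance heartGproj_isStableUnderRetracts [IsTriangulated T] :
    (heartGproj t).IsStableUnderRetracts where
  of_retract {M₀ Y₀} r₀ hY₀ := by
    refine ⟨(heartGproj t).retractClosure, ?_, ?_, ⟨Y₀, hY₀, ⟨r₀⟩⟩⟩
    · rintro M ⟨Y, hY, ⟨r⟩⟩
      have h := heartGproj_le_heartPerp Y hY
      exact ⟨prop_of_retract _ r h.1, fun k hk => prop_of_retract _ r (h.2 k hk)⟩
    · rintro M ⟨Y, hY, ⟨r⟩⟩
      obtain ⟨N, g, h, hN⟩ := distinguished_cocone_triangle r.i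
      obtain ⟨e⟩ := nonempty_iso_biprod_of_retract r hN
      obtain ⟨A, P, a, b, δ, hT, hA, hP⟩ := heartGproj_le_cosyzygy Y hY
      obtain ⟨C, c, γ, hC⟩ := distinguished_cocone_triangle (r.i ≫ b)
      let o := someOctahedron rfl hN (rot_of_distTriang _ hT) hC
      have hNM : heartGproj t (N ⊞ M) := prop_of_iso _ (e ≪≫ biprod.braiding _ _) hY
      obtain ⟨_, _, _, hS⟩ := exists_distTriang_biprod o.mem (contractible_distinguished M)
      have hA0 : heartGproj t (A⟦(1 : ℤ)⟧ ⊞ 0) := heartGproj_extensionProduct_le _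
        (extensionProduct_biprod hA (prop_of_isZero _ (isZero_zero T)))
      have hCM : heartGproj t (C ⊞ M) :=
        heartGproj_extensionProduct_le _ ⟨_, _, _, _, _, hS, hNM, hA0⟩
      refine ⟨_, _, _, _, _, inv_rot_of_distTriang _ hC, ?_, hP⟩
      have hC' : (heartGproj t).retractClosure C :=
        ⟨C ⊞ M, hCM, ⟨{ i := (biprod.inl : C ⟶ C ⊞ M), r := biprod.fst }⟩⟩
      exact (heartGproj t).retractClosure.prop_of_iso
        ((shiftFunctorCompIsoId T (-1) (1 : ℤ) (by lia)).symm.app C) hC'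

instance isResolving_heartGproj [IsTriangulated T] : IsResolving t (heartGproj t) where
  heartProj_le := heartProj_le_heartGproj
  le_heart M hM := (heartGproj_le_heartPerp M hM).1
  homZero := homZero_heartGproj
  le_cosyzygy := heartGproj_le_cosyzygy
  extension_le := heartGproj_extensionProduct_le
  kernel_le M hM := by
    refine ⟨_, fun X hX => ⟨⟨hX.2, ?_⟩, fun k hk => ?_⟩, fun X hX => ?_, hM⟩
    · refine ge_extensionProduct_ge 0 X (extensionProduct_mono ?_ ?_ X hX.1)
      · exact ((shift_mono (fun Y hY => (heartGproj_le_heartPerp Y hY).1) 1).trans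
          (heart_shift_le_ge 1)).trans (t.ge_antitone (by lia))
      · exact fun Y hY => (heartGproj_le_heartPerp Y hY).1.2
    · refine HomZero.extensionProduct_left ?_ (homZero_heartGproj k hk) X hX.1
      have := (homZero_heartGproj (t := t) (k - 1) (by lia)).shift 1
      rwa [shift_shift_eq _ (show (1 : ℤ) + (k - 1) = k by lia)] at this
    · have h := extensionProduct_mono le_rfl heartGproj_le_cosyzygy X hX.1
      rw [← extensionProduct_assoc] at h
      refine extensionProduct_mono ?_ le_rfl X h
      refine (extensionProduct_shift_le _ _ _).trans (shift_mono ?_ 1)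
      refine heartGproj_extensionProduct_le.trans fun Y hY => ⟨?_, ?_⟩
      · exact le_extensionProduct_right ((heartGproj t).shift (1 : ℤ)) Y hY
      · exact (heartGproj_le_heartPerp Y hY).1.1

end Gorenstein

/-! ### The opposite t-structure -/

section OppositeTStructure

open Opposite CategoryTheory.Pretriangulated.Opposite

variable {T : Type u} [Category.{v} T] [Preadditive T] [HasZeroObject T] [HasShift T ℤ]
  [∀ n : ℤ, (shiftFunctor T n).Additive] [Pretriangulated T]

/-- The opposite t-structure; degrees change sign, so that `le n` consists of the objects that are
`≥ -n` for `t`. -/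
def opTStructure (t : TStructure T) : TStructure Tᵒᵖ where
  le n := (t.ge (-n)).op
  ge n := (t.le (-n)).op
  le_shift n a n' h X hX :=
    prop_of_iso (t.ge (-n')).op ((shiftFunctorOpIso T a (-a) (by lia)).symm.app X)
      (t.ge_shift (-n) (-a) (-n') (by lia) X.unop hX)
  ge_shift n a n' h X hX :=
    prop_of_iso (t.le (-n')).op ((shiftFunctorOpIso T a (-a) (by lia)).symm.app X)
      (t.le_shift (-n) (-a) (-n') (by lia) X.unop hX)
  zero' X Y f hX hY := by
    have : t.IsLE Y.unop (-1) := ⟨hY⟩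
    have : t.IsGE X.unop 0 := ⟨hX⟩
    exact Quiver.Hom.unop_inj (t.zero f.unop (-1) 0 (by lia))
  le_zero_le X hX := t.ge_antitone (show (-1 : ℤ) ≤ -0 by lia) X.unop hX
  ge_one_le X hX := t.le_monotone (show (-1 : ℤ) ≤ -0 by lia) X.unop hX
  exists_triangle_zero_one A := by
    obtain ⟨X, Y, hX, hY, f, g, h, hT⟩ := t.exists_triangle A.unop (-1) 0 (by lia)
    exact ⟨op Y, op X, hY, hX, _, _, _, op_distinguished _ hT⟩

lemma op_addClosure {P : ObjectProperty T} {M : T} (hM : addClosure P M) :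
    addClosure P.op (op M) := by
  obtain ⟨n, f, b, N, hf, ⟨hb⟩, ⟨e⟩⟩ := hM
  let b' : Bicone (fun j => op (f j)) :=
    { pt := op b.pt
      π := fun j => (b.ι j).op
      ι := fun j => (b.π j).op
      ι_π := fun j j' => by
        rw [← op_comp, b.ι_π]
        by_cases h : j' = j
        · subst h
          rw [dif_pos rfl, dif_pos rfl, eqToHom_refl, eqToHom_refl, op_id]
        · rw [dif_neg h, dif_neg (Ne.symm h), op_zero] }
  have hb' : b'.IsBilimit := isBilimitOfTotal _ (Quiver.Hom.unop_inj (by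
    refine Eq.trans ?_ (IsBilimit.total hb)
    rw [unop_sum]
    rfl))
  let c : BinaryBicone (op M) (op N) := (BinaryBiproduct.bicone M N).op
  exact ⟨n, _, b', op N, hf, ⟨hb'⟩, ⟨(biprod.uniqueUpToIso _ _
    (BinaryBiproduct.isBilimit M N).op).symm ≪≫ e.symm.op⟩⟩

lemma op_shiftClosure {P : ObjectProperty T} {M : T} (hM : P.shiftClosure ℤ M) :
    P.op.shiftClosure ℤ (op M) := by
  obtain ⟨A, a, e, hA⟩ := hM
  exact ⟨op A, -a, e.symm.op ≪≫ (shiftFunctorOpIso T (-a) a (by lia)).symm.app (op A), hA⟩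

lemma op_angle {P : ObjectProperty T} {M : T} (hM : angle P M) : angle P.op (op M) :=
  addClosure_mono (fun _ hX => op_shiftClosure hX) _ (op_addClosure hM)

/-- Formation of opposites reverses the order of the factors in the definition of `angleIter`. -/
lemma op_angleIter {P : ObjectProperty T} {R : ℕ → ObjectProperty Tᵒᵖ}
    (h₀ : ∀ M, IsZero M → R 0 M) (h₁ : angle P.op ≤ R 1)
    (h : ∀ r, angle (angle P.op ∗ R (r + 1)) ≤ R (r + 2)) (r : ℕ) {M : T}
    (hM : angleIter P r M) : R r (op M) := by
  induction r generalizing M with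
  | zero => exact h₀ _ (IsZero.op hM)
  | succ r ih =>
    cases r with
    | zero => exact h₁ _ (op_angle hM)
    | succ r =>
      refine h r _ (angle_mono ?_ _ (op_angle hM))
      intro X hX
      obtain ⟨A, B, _, _, _, hT, hA, hB⟩ := (hX : (angleIter P (r + 1) ∗ angle P) X.unop)
      exact ⟨_, _, _, _, _, op_distinguished _ hT, op_angle hB, ih hA⟩

/-- The level bound for the opposite t-structure. The level is that of `M` itself, not that of its
opposite. -/
theorem tower_op_of_angleIter [IsTriangulated T] {t : TStructure T} {G : ObjectProperty T}
    (ht : EnoughProj (opTStructure t)) (hG : IsResolving (opTStructure t) G.op)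
    {M : T} {r : ℕ} (hM : angleIter G (r + 1) M) {s i : ℤ} (his : i ≤ s) (hs : t.le s M)
    (hi : t.ge i M) : tower G.op (-i) ((s - i).toNat + 1 + r) (op M) := by
  have := boundedTower_isTriangulated ht hG
  have := boundedTower_isStableUnderRetracts ht hG
  have hb : boundedTower G.op (op M) :=
    op_angleIter (R := fun _ => boundedTower G.op) (fun M hM => prop_of_isZero _ hM)
      (angle_le le_boundedTower)
      (fun r => angle_le (extensionProduct_le_of_isTriangulatedClosed₂
        (angle_le le_boundedTower) le_rfl)) _ hM
  have hg : ghostKernel G.op (r + 1) (op M) :=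
    op_angleIter (fun M hM Y f _ => IsZero.eq_of_src hM f 0) angle_le_ghostKernel_one
      (fun r => angle_le_ghostKernel ((extensionProduct_mono angle_le_ghostKernel_one le_rfl).trans
        (one_extensionProduct_le_ghostKernel _))) _ hM
  have h := tower_of_ghostKernel ht hG hb hg (s := -i) (i := -s) (by lia)
    (show t.ge (- -i) M by rwa [neg_neg]) (show t.le (- -s) M by rwa [neg_neg])
  rwa [show -i - -s = s - i by ring] at h

end OppositeTStructure

/-! ### Enough projective objects -/

section EnoughProj

variable {T : Type u} [Category.{v} T] [Preadditive T] [HasZeroObject T] [HasShift T ℤ]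
  [∀ n : ℤ, (shiftFunctor T n).Additive] [Pretriangulated T] [IsTriangulated T]
  {t : TStructure T}

lemma le_le_extensionProduct_heart : t.le 0 ≤ t.le (-1) ∗ t.heart := by
  intro M hM
  obtain ⟨X, Y, hX, hY, f, g, h, hT⟩ := t.exists_triangle M (-1) 0 (by lia)
  refine ⟨X, Y, f, g, h, hT, hX, ?_, hY⟩
  exact le_extensionProduct_le 0 Y ⟨_, _, _, _, _, rot_of_distTriang _ hT, hM,
    t.le_monotone (by lia) _ (t.le_shift (-1) 1 (-2) (by lia) _ hX)⟩

lemma enoughProj_of_heart (h : t.heart ≤ heartProj t ∗ t.le (-1)) : EnoughProj t := by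
  have hs : t.le (-1) ∗ heartProj t ≤ heartProj t ∗ t.le (-1) :=
    extensionProduct_swap fun _ _ hX hY f =>
      hY.2 f (t.le_monotone (by lia) _ (t.le_shift (-1) 1 (-2) (by lia) _ hX))
  refine (le_le_extensionProduct_heart.trans (extensionProduct_mono le_rfl h)).trans ?_
  rw [← extensionProduct_assoc]
  refine (extensionProduct_mono hs le_rfl).trans ?_
  rw [extensionProduct_assoc]
  exact extensionProduct_mono le_rfl (le_extensionProduct_le (-1))

end EnoughProj

/-! ### Gorenstein projective objects of an abelian category and of a heart -/

universe v₁ u₁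

section Cosyzygy

variable {B : Type u₁} [Category.{v₁} B] [Abelian B]

/-- `Z'` is a cosyzygy of `Z`: it is the cokernel of a monomorphism from `Z` to a projective object
along which all morphisms from `Z` to projective objects extend. -/
def IsCosyzygy (Z Z' : B) : Prop :=
  ∃ (P : B) (f : Z ⟶ P) (g : P ⟶ Z') (w : f ≫ g = 0), (ShortComplex.mk f g w).ShortExact ∧
    Projective P ∧ ∀ ⦃Q : B⦄, Projective Q → ∀ a : Z ⟶ Q, ∃ b : P ⟶ Q, f ≫ b = a

/-- The class `Z` is closed under taking suitable cosyzygies and syzygies. -/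
structure IsCosyzygyClosed (Z : ObjectProperty B) : Prop where
  exists_right : ∀ X, Z X → ∃ Y, Z Y ∧ IsCosyzygy X Y
  exists_left : ∀ X, Z X → ∃ Y, Z Y ∧ IsCosyzygy Y X

end Cosyzygy

section Heart

variable {B : Type u₁} [Category.{v₁} B] [Abelian B]
variable {T : Type u} [Category.{v} T] [Preadditive T] [HasZeroObject T] [HasShift T ℤ]
  [∀ n : ℤ, (shiftFunctor T n).Additive] [Pretriangulated T] {t : TStructure T}

/-- The fully faithful functor `F` identifies the abelian category `B` with the heart of `t`, short
exact sequences give exact triangles, and projective objects of `B` admit no nonzero morphisms to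
the objects of `t.le (-1)`, including those that are unbounded. -/
structure IsHeartEmbedding (t : TStructure T) (F : B ⥤ T) : Prop where
  heart_obj (X : B) : t.heart (F.obj X)
  exists_iso (M : T) : t.heart M → ∃ X : B, Nonempty (F.obj X ≅ M)
  exists_distTriang (S : ShortComplex B) : S.ShortExact →
    ∃ h, Triangle.mk (F.map S.f) (F.map S.g) h ∈ distTriang T
  heartProj_obj (P : B) : Projective P → heartProj t (F.obj P)

variable {F : B ⥤ T} [F.Full] [F.Faithful] [F.PreservesZeroMorphisms]

lemma IsHeartEmbedding.shortExact (hF : IsHeartEmbedding t F) {X Y Z : B} {f : X ⟶ Y} {g : Y ⟶ Z}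
    {h : F.obj Z ⟶ (F.obj X)⟦(1 : ℤ)⟧}
    (hT : Triangle.mk (F.map f) (F.map g) h ∈ distTriang T) :
    ∃ w, (ShortComplex.mk f g w).ShortExact := by
  have w : f ≫ g = 0 := F.map_injective (by
    have : F.map f ≫ F.map g = 0 := comp_distTriang_mor_zero₁₂ _ hT
    rw [F.map_comp, this, F.map_zero])
  have hmono : Mono f := by
    refine Preadditive.mono_of_cancel_zero _ fun {W} a ha => F.map_injective ?_
    rw [F.map_zero]
    have h0 : F.map a ≫ F.map f = 0 := by rw [← F.map_comp, ha, F.map_zero]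
    obtain ⟨r, q, hq⟩ : ∃ (r : (F.obj Z)⟦(-1 : ℤ)⟧ ⟶ F.obj X) (q : F.obj W ⟶ (F.obj Z)⟦(-1 : ℤ)⟧),
        F.map a = q ≫ r :=
      ⟨_, Triangle.coyoneda_exact₂ _ (inv_rot_of_distTriang _ hT) (F.map a) h0⟩
    have hq0 : q = 0 := (homZero_le_ge (by lia : (0 : ℤ) < 1)).eq_zero (hF.heart_obj W).1
      (t.ge_shift 0 (-1) 1 (by lia) _ (hF.heart_obj Z).2) q
    rw [hq, hq0, zero_comp]
  have hepi : Epi g := by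
    refine Preadditive.epi_of_cancel_zero _ fun {W} a ha => F.map_injective ?_
    rw [F.map_zero]
    have h0 : F.map g ≫ F.map a = 0 := by rw [← F.map_comp, ha, F.map_zero]
    obtain ⟨q, hq⟩ : ∃ q : (F.obj X)⟦(1 : ℤ)⟧ ⟶ F.obj W, F.map a = h ≫ q :=
      Triangle.yoneda_exact₂ _ (rot_of_distTriang _ hT) (F.map a) h0
    have hq0 : q = 0 := (homZero_le_ge (by lia : (-1 : ℤ) < 0)).eq_zero
      (t.le_shift 0 1 (-1) (by lia) _ (hF.heart_obj X).1) (hF.heart_obj W).2 q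
    rw [hq, hq0, comp_zero]
  refine ⟨w, .mk' (ShortComplex.exact_of_f_is_kernel _
    (KernelFork.IsLimit.ofι' f w fun {W} a ha => ?_)) hmono hepi⟩
  have h0 : F.map a ≫ F.map g = 0 := by rw [← F.map_comp, ha, F.map_zero]
  have hq : ∃ q : F.obj W ⟶ F.obj X, F.map a = q ≫ F.map f :=
    Triangle.coyoneda_exact₂ _ hT (F.map a) h0
  refine ⟨F.preimage hq.choose, F.map_injective ?_⟩
  rw [F.map_comp, F.map_preimage]
  exact hq.choose_spec.symm

lemma IsHeartEmbedding.exists_shortExact (hF : IsHeartEmbedding t F) {X Y Z : B}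
    {i : F.obj X ⟶ F.obj Y} {p : F.obj Y ⟶ F.obj Z} {h : F.obj Z ⟶ (F.obj X)⟦(1 : ℤ)⟧}
    (hT : Triangle.mk i p h ∈ distTriang T) :
    ∃ (f : X ⟶ Y) (g : Y ⟶ Z) (w : f ≫ g = 0), (ShortComplex.mk f g w).ShortExact := by
  obtain ⟨f, rfl⟩ := F.map_surjective i
  obtain ⟨g, rfl⟩ := F.map_surjective p
  obtain ⟨w, hw⟩ := hF.shortExact hT
  exact ⟨f, g, w, hw⟩

lemma IsHeartEmbedding.projective_of_heartProj (hF : IsHeartEmbedding t F) {P : B}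
    (hP : heartProj t (F.obj P)) : Projective P where
  factors {E X} f e _ := by
    obtain ⟨h, hT⟩ := hF.exists_distTriang (ShortComplex.mk _ _ (kernel.condition e))
      { exact := ShortComplex.exact_of_f_is_kernel _ (kernelIsKernel e) }
    have hT : Triangle.mk (F.map (kernel.ι e)) (F.map e) h ∈ distTriang T := hT
    have h0 : F.map f ≫ h = 0 :=
      hP.2 _ (t.le_shift 0 1 (-1) (by lia) _ (hF.heart_obj (kernel e)).1)
    obtain ⟨q, hq⟩ : ∃ q : F.obj P ⟶ F.obj E, F.map f = q ≫ F.map e :=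
      Triangle.coyoneda_exact₂ _ (rot_of_distTriang _ hT) (F.map f) h0
    refine ⟨F.preimage q, F.map_injective ?_⟩
    rw [F.map_comp, F.map_preimage, hq]

lemma IsHeartEmbedding.heart_le_heartProj [EnoughProjectives B] (hF : IsHeartEmbedding t F) :
    t.heart ≤ heartProj t ∗ t.le (-1) := by
  intro M hM
  obtain ⟨X, ⟨e⟩⟩ := hF.exists_iso M hM
  refine prop_of_iso _ e ?_
  obtain ⟨h, hT⟩ := hF.exists_distTriang (ShortComplex.mk _ _ (kernel.condition (Projective.π X)))
    { exact := ShortComplex.exact_of_f_is_kernel _ (kernelIsKernel _) }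
  exact ⟨_, _, _, _, _, rot_of_distTriang _ hT, hF.heartProj_obj _ inferInstance,
    t.le_shift 0 1 (-1) (by lia) _ (hF.heart_obj _).1⟩

end Heart

section GorensteinHeart

variable {B : Type u₁} [Category.{v₁} B] [Abelian B]
variable {T : Type u} [Category.{v} T] [Preadditive T] [HasZeroObject T] [HasShift T ℤ]
  [∀ n : ℤ, (shiftFunctor T n).Additive] [Pretriangulated T] {t : TStructure T}
variable {F : B ⥤ T} [F.Full] [F.Faithful] [F.PreservesZeroMorphisms]

lemma prop_shift_obj {P : ObjectProperty T} [P.IsClosedUnderIsomorphisms] {a b : ℤ}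
    (h : a + b = 0) {X : T} (hX : P X) : P.shift b (X⟦a⟧) :=
  P.prop_of_iso ((shiftFunctorCompIsoId T a b h).symm.app X) hX

lemma homZero_heartGproj_shift [IsTriangulated T] :
    HomZero ((heartGproj t).shift (1 : ℤ)) (heartProj t) := by
  have h := (homZero_heartGproj (t := t) (-1) (by lia)).shift 1
  rwa [shift_shift_eq _ (show (1 : ℤ) + -1 = 0 by lia), shift_zero] at h

/-- Morphisms to projective objects extend along a monomorphism whose cokernel is Gorenstein
projective. -/
lemma IsHeartEmbedding.isCosyzygy [IsTriangulated T] (hF : IsHeartEmbedding t F) {X P Y : B}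
    {f : X ⟶ P} {g : P ⟶ Y} {w : f ≫ g = 0} (hS : (ShortComplex.mk f g w).ShortExact)
    (hP : Projective P) (hY : heartGproj t (F.obj Y)) : IsCosyzygy X Y := by
  refine ⟨P, f, g, w, hS, hP, fun Q hQ a => ?_⟩
  obtain ⟨h, hT⟩ := hF.exists_distTriang _ hS
  have hT : Triangle.mk (F.map f) (F.map g) h ∈ distTriang T := hT
  obtain ⟨q, hq⟩ : ∃ q : F.obj P ⟶ F.obj Q, F.map a = F.map f ≫ q :=
    Triangle.yoneda_exact₂ _ (inv_rot_of_distTriang _ hT) (F.map a)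
      (homZero_heartGproj_shift.eq_zero (prop_shift_obj (by lia) hY) (hF.heartProj_obj Q hQ) _)
  refine ⟨F.preimage q, F.map_injective ?_⟩
  rw [F.map_comp, F.map_preimage, hq]

lemma IsHeartEmbedding.isCosyzygyClosed [EnoughProjectives B] [IsTriangulated T]
    (hF : IsHeartEmbedding t F) :
    IsCosyzygyClosed ((heartGproj t).inverseImage F) where
  exists_right X hX := by
    obtain ⟨M, N, i, p, h, hT, hM, hN⟩ := heartGproj_le_cosyzygy _ hX
    obtain ⟨P, ⟨eP⟩⟩ := hF.exists_iso N hN.1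
    obtain ⟨Y, ⟨eY⟩⟩ := hF.exists_iso _ (heartGproj_le_heartPerp _ hM).1
    obtain ⟨_, _, _, hT'⟩ := exists_distTriang_of_iso (rot_of_distTriang _ hT) (Iso.refl _) eP eY
    obtain ⟨f, g, w, hw⟩ := hF.exists_shortExact hT'
    have hY : heartGproj t (F.obj Y) := prop_of_iso _ eY.symm hM
    exact ⟨Y, hY, hF.isCosyzygy hw (hF.projective_of_heartProj (prop_of_iso _ eP.symm hN)) hY⟩
  exists_left X hX := by
    have hw := kernel.condition (Projective.π X)
    have hS : (ShortComplex.mk _ _ hw).ShortExact :=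
      { exact := ShortComplex.exact_of_f_is_kernel _ (kernelIsKernel _) }
    obtain ⟨h, hT⟩ := hF.exists_distTriang _ hS
    refine ⟨kernel (Projective.π X), ?_, hF.isCosyzygy hS inferInstance hX⟩
    exact isResolving_heartGproj.kernel_le _ ⟨⟨_, _, _, _, _, inv_rot_of_distTriang _ hT,
      prop_shift_obj (by lia) hX, heartProj_le_heartGproj _ (hF.heartProj_obj _ inferInstance)⟩,
      (hF.heart_obj _).1⟩

/-- The objects of a class that is closed under cosyzygies and syzygies are Gorenstein projective
in the heart; the vanishing of their higher extensions with projective objects is obtained by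
dimension shifting along syzygies. -/
lemma IsHeartEmbedding.heartGproj_of_isCosyzygyClosed (hF : IsHeartEmbedding t F)
    {Z : ObjectProperty B} (hZ : IsCosyzygyClosed Z) {X : B} (hX : Z X) :
    heartGproj t (F.obj X) := by
  have hP := isResolving_heartProj t
  have h1 : HomZero (Z.map F) ((heartProj t).shift (-1 : ℤ)) := by
    rintro M ⟨X, hX, ⟨e⟩⟩ N a hN
    obtain ⟨Y, hY, P, f, g, w, hS, hP', hYP⟩ := hZ.exists_left X hX
    obtain ⟨h, hT⟩ := hF.exists_distTriang _ hS
    have hT : Triangle.mk (F.map f) (F.map g) h ∈ distTriang T := hT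
    obtain ⟨Q, ⟨eQ⟩⟩ := hF.exists_iso _ (hN : heartProj t (N⟦(-1 : ℤ)⟧)).1
    have hQ : Projective Q := hF.projective_of_heartProj (prop_of_iso _ eQ.symm hN)
    let e' : (F.obj Q)⟦(1 : ℤ)⟧ ≅ N :=
      (shiftFunctor T (1 : ℤ)).mapIso eQ ≪≫ (shiftFunctorCompIsoId T (-1 : ℤ) 1 (by lia)).app N
    obtain ⟨b, hb⟩ : ∃ b : (F.obj Y)⟦(1 : ℤ)⟧ ⟶ N, e.hom ≫ a = h ≫ b :=
      Triangle.yoneda_exact₂ _ (rot_of_distTriang _ hT) (e.hom ≫ a)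
        ((hP.homZero (-1) (by lia)).eq_zero (hF.heartProj_obj P hP') hN _)
    obtain ⟨c, hc⟩ := (shiftFunctor T (1 : ℤ)).map_surjective (b ≫ e'.inv)
    obtain ⟨d, rfl⟩ := F.map_surjective c
    obtain ⟨d', rfl⟩ := hYP hQ d
    have h0 : h ≫ (F.map f)⟦(1 : ℤ)⟧' = 0 := comp_distTriang_mor_zero₃₁ _ hT
    have h2 : h ≫ b = 0 := by
      rw [← cancel_mono e'.inv, Category.assoc, ← hc, F.map_comp, Functor.map_comp,
        reassoc_of% h0, zero_comp, zero_comp]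
    rw [← cancel_epi e.hom, hb, h2, comp_zero]
  have h2 : Z.map F ≤ heartProj t ∗ (Z.map F).shift (-1 : ℤ) := by
    rintro M ⟨X, hX, ⟨e⟩⟩
    obtain ⟨Y, hY, P, f, g, w, hS, hP', -⟩ := hZ.exists_left X hX
    obtain ⟨h, hT⟩ := hF.exists_distTriang _ hS
    refine prop_of_iso _ e ⟨_, _, _, _, _, rot_of_distTriang _ hT, hF.heartProj_obj P hP', ?_⟩
    exact prop_shift_obj (by lia) (prop_map_obj _ _ hY)
  have h3 (n : ℕ) : HomZero (Z.map F) ((heartProj t).shift (-1 - n : ℤ)) := by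
    induction n with
    | zero => simpa using h1
    | succ n ih =>
      refine HomZero.mono (HomZero.extensionProduct_left (hP.homZero _ (by lia)) ?_) h2 le_rfl
      have := ih.shift (-1)
      rwa [shift_shift_eq _ (show -1 + (-1 - (n : ℤ)) = -1 - ((n + 1 : ℕ) : ℤ) by
        push_cast; ring)] at this
  refine ⟨Z.map F, ?_, ?_, ⟨X, hX, ⟨Iso.refl _⟩⟩⟩
  · rintro M hM
    refine ⟨?_, fun k hk => ?_⟩
    · obtain ⟨X, hX, ⟨e⟩⟩ := hM
      exact prop_of_iso _ e (hF.heart_obj X)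
    · obtain ⟨n, rfl⟩ : ∃ n : ℕ, k = -1 - n := ⟨(-1 - k).toNat, by lia⟩
      exact h3 n M hM
  · rintro M ⟨X, hX, ⟨e⟩⟩
    obtain ⟨Y, hY, P, f, g, w, hS, hP', -⟩ := hZ.exists_right X hX
    obtain ⟨h, hT⟩ := hF.exists_distTriang _ hS
    refine prop_of_iso _ e ⟨_, _, _, _, _, inv_rot_of_distTriang _ hT, ?_, hF.heartProj_obj P hP'⟩
    exact prop_shift_obj (by lia) (prop_map_obj _ _ hY)

end GorensteinHeart

/-! ### Complete resolutions -/

section Chains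

/-- A relation on a set in which all elements have a successor and a predecessor has bi-infinite
chains through all elements. -/
lemma exists_int_chain {α : Type*} {R : α → α → Prop} {s : α → Prop}
    (hr : ∀ a, s a → ∃ b, s b ∧ R a b) (hl : ∀ a, s a → ∃ b, s b ∧ R b a) {a : α} (ha : s a)
    (k : ℤ) : ∃ z : ℤ → α, z k = a ∧ ∀ i, R (z i) (z (i + 1)) := by
  choose! r hrs hr using hr
  choose! l hls hl using hl
  have hrs' (n : ℕ) : s (r^[n] a) := by
    induction n with
    | zero => exact ha
    | succ n ih => rw [Function.iterate_succ_apply']; exact hrs _ ih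
  have hls' (n : ℕ) : s (l^[n] a) := by
    induction n with
    | zero => exact ha
    | succ n ih => rw [Function.iterate_succ_apply']; exact hls _ ih
  let z : ℤ → α := fun i => if 0 ≤ i then r^[i.toNat] a else l^[(-i).toNat] a
  have hz (i : ℤ) : R (z i) (z (i + 1)) := by
    obtain hi | hi := le_or_gt 0 i
    · have h : (i + 1).toNat = i.toNat + 1 := by lia
      simp only [z, hi, show (0 : ℤ) ≤ i + 1 by lia, if_true, h, Function.iterate_succ_apply']
      exact hr _ (hrs' _)
    · obtain ⟨n, rfl⟩ : ∃ n : ℕ, i = -(n + 1) := ⟨(-i - 1).toNat, by lia⟩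
      have h : z (-((n : ℤ) + 1) + 1) = l^[n] a := by
        obtain rfl | hn := Nat.eq_zero_or_pos n
        · simp [z]
        · simp only [z, show ¬ (0 : ℤ) ≤ -(n + 1) + 1 by lia, if_false]
          congr 2
          lia
      have h' : z (-((n : ℤ) + 1)) = l (l^[n] a) := by
        rw [← Function.iterate_succ_apply' l]
        simp only [z, show ¬ (0 : ℤ) ≤ -(n + 1) by lia, if_false]
        congr 2
      rw [h, h']
      exact hl _ (hls' _)
  refine ⟨fun i => z (i - k), by simp [z], fun i => ?_⟩
  have := hz (i - k)
  rwa [show i - k + 1 = i + 1 - k by ring] at this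

end Chains

section Splice

variable {B : Type u} [Category.{v} B] [Abelian B] {Z P : ℤ → B} {f : ∀ i, Z i ⟶ P i}
  {g : ∀ i, P i ⟶ Z (i + 1)} {w : ∀ i, f i ≫ g i = 0}

/-- The complex spliced from short exact sequences `Z i ⟶ P i ⟶ Z (i + 1)`. -/
def splice (w : ∀ i, f i ≫ g i = 0) : CochainComplex B ℤ :=
  CochainComplex.of P (fun i => g i ≫ f (i + 1)) (fun i => by
    rw [Category.assoc, ← Category.assoc (f (i + 1)), w, zero_comp, comp_zero])

lemma splice_d (i : ℤ) : (splice w).d i (i + 1) = g i ≫ f (i + 1) :=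
  CochainComplex.of_d P (fun i => g i ≫ f (i + 1)) i

lemma splice_acyclic (hS : ∀ i, (ShortComplex.mk (f i) (g i) (w i)).ShortExact) :
    (splice w).Acyclic := by
  intro i
  obtain ⟨i, rfl⟩ : ∃ j, i = j + 1 := ⟨i - 1, by ring⟩
  rw [HomologicalComplex.exactAt_iff' _ i (i + 1) (i + 1 + 1) (by simp) (by simp)]
  have := (hS i).epi_g
  have := (hS (i + 1 + 1)).mono_f
  have w₁ : (g i ≫ f (i + 1)) ≫ g (i + 1) = 0 := by rw [Category.assoc, w, comp_zero]
  have h₁ : (ShortComplex.mk (g i ≫ f (i + 1)) (g (i + 1)) w₁).Exact := by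
    let φ : ShortComplex.mk (g i ≫ f (i + 1)) (g (i + 1)) w₁ ⟶
        ShortComplex.mk (f (i + 1)) (g (i + 1)) (w (i + 1)) :=
      { τ₁ := g i, τ₂ := 𝟙 _, τ₃ := 𝟙 _ }
    have : Epi φ.τ₁ := (hS i).epi_g
    have : IsIso φ.τ₂ := inferInstanceAs (IsIso (𝟙 _))
    have : Mono φ.τ₃ := inferInstanceAs (Mono (𝟙 _))
    exact (ShortComplex.exact_iff_of_epi_of_isIso_of_mono φ).2 (hS (i + 1)).exact
  let φ : ShortComplex.mk (g i ≫ f (i + 1)) (g (i + 1)) w₁ ⟶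
      (splice w).sc' i (i + 1) (i + 1 + 1) :=
    { τ₁ := 𝟙 (P i), τ₂ := 𝟙 (P (i + 1)), τ₃ := f (i + 1 + 1)
      comm₁₂ := (Category.id_comp _).trans ((splice_d (w := w) i).trans (Category.comp_id _).symm)
      comm₂₃ := (Category.id_comp _).trans (splice_d (w := w) (i + 1)) }
  have : Epi φ.τ₁ := inferInstanceAs (Epi (𝟙 _))
  have : IsIso φ.τ₂ := inferInstanceAs (IsIso (𝟙 _))
  have : Mono φ.τ₃ := (hS (i + 1 + 1)).mono_f
  exact (ShortComplex.exact_iff_of_epi_of_isIso_of_mono φ).1 h₁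

lemma nonempty_iso_opcycles_splice
    (hS : ∀ i, (ShortComplex.mk (f i) (g i) (w i)).ShortExact) (j : ℤ) :
    Nonempty (Z (j + 1) ≅ (splice w).opcycles j) := by
  obtain ⟨i, rfl⟩ : ∃ i, j = i + 1 := ⟨j - 1, by ring⟩
  have := (hS i).epi_g
  exact ⟨(isCokernelEpiComp (hS (i + 1)).gIsCokernel (g i) (splice_d (w := w) i)
    ).coconePointUniqueUpToIso ((splice w).opcyclesIsCokernel i (i + 1) (by simp))⟩

lemma nonempty_iso_cycles_splice
    (hS : ∀ i, (ShortComplex.mk (f i) (g i) (w i)).ShortExact) (i : ℤ) :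
    Nonempty (Z i ≅ (splice w).cycles i) := by
  have := (hS (i + 1)).mono_f
  exact ⟨(isKernelCompMono (hS i).fIsKernel (f (i + 1)) (splice_d (w := w) i)
    ).conePointUniqueUpToIso ((splice w).cyclesIsKernel i (i + 1) (by simp))⟩

end Splice

section HomExact

variable {B : Type u} [Category.{v} B] [Abelian B]

lemma exact_sc_op_map_iff (K : CochainComplex B ℤ) (Q : B) {i j k : ℤ} (hi : i + 1 = j)
    (hk : j + 1 = k) : ((K.sc j).op.map (preadditiveYoneda.obj Q)).Exact ↔
      ∀ a : K.X j ⟶ Q, K.d i j ≫ a = 0 → ∃ b : K.X k ⟶ Q, K.d j k ≫ b = a := by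
  obtain rfl : (ComplexShape.up ℤ).prev j = i := by simp [← hi]
  obtain rfl : (ComplexShape.up ℤ).next j = k := by simp [← hk]
  exact ShortComplex.ab_exact_iff _

lemma exact_sc_map_iff (K : CochainComplex B ℤ) (J : B) {i j k : ℤ} (hi : i + 1 = j)
    (hk : j + 1 = k) :
    ((K.sc j).map (preadditiveCoyoneda.obj (Opposite.op J))).Exact ↔
      ∀ a : J ⟶ K.X j, a ≫ K.d j k = 0 → ∃ b : J ⟶ K.X i, b ≫ K.d i j = a := by
  obtain rfl : (ComplexShape.up ℤ).prev j = i := by simp [← hi]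
  obtain rfl : (ComplexShape.up ℤ).next j = k := by simp [← hk]
  exact ShortComplex.ab_exact_iff _

lemma shortExact_opcycles {K : CochainComplex B ℤ} (hK : K.Acyclic) {i j : ℤ} (h : i + 1 = j) :
    ∃ w, (ShortComplex.mk (K.fromOpcycles i j) (K.pOpcycles j) w).ShortExact := by
  have hj : (ComplexShape.up ℤ).next i = j := by simp [← h]
  have hi : (ComplexShape.up ℤ).prev j = i := by simp [← h]
  have w : K.fromOpcycles i j ≫ K.pOpcycles j = 0 := by
    rw [← cancel_epi (K.pOpcycles i), K.p_fromOpcycles_assoc, K.d_pOpcycles, comp_zero]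
  refine ⟨w, .mk' ?_ ?_ inferInstance⟩
  · let φ : ShortComplex.mk (K.d i j) (K.pOpcycles j) (K.d_pOpcycles i j) ⟶
        ShortComplex.mk (K.fromOpcycles i j) (K.pOpcycles j) w :=
      { τ₁ := K.pOpcycles i, τ₂ := 𝟙 _, τ₃ := 𝟙 _ }
    have : Epi φ.τ₁ := inferInstanceAs (Epi (K.pOpcycles i))
    have : IsIso φ.τ₂ := inferInstanceAs (IsIso (𝟙 _))
    have : Mono φ.τ₃ := inferInstanceAs (Mono (𝟙 _))
    exact (ShortComplex.exact_iff_of_epi_of_isIso_of_mono φ).1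
      (ShortComplex.exact_of_g_is_cokernel _ (K.opcyclesIsCokernel i j hi))
  · subst hj
    exact (hK i).mono_fromOpcycles

lemma shortExact_cycles {K : CochainComplex B ℤ} (hK : K.Acyclic) {i j : ℤ} (h : i + 1 = j) :
    ∃ w, (ShortComplex.mk (K.iCycles i) (K.toCycles i j) w).ShortExact := by
  have hj : (ComplexShape.up ℤ).next i = j := by simp [← h]
  have hi : (ComplexShape.up ℤ).prev j = i := by simp [← h]
  have w : K.iCycles i ≫ K.toCycles i j = 0 := by
    rw [← cancel_mono (K.iCycles j), Category.assoc, K.toCycles_i, K.iCycles_d, zero_comp]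
  refine ⟨w, .mk' ?_ inferInstance ?_⟩
  · let φ : ShortComplex.mk (K.iCycles i) (K.toCycles i j) w ⟶
        ShortComplex.mk (K.iCycles i) (K.d i j) (K.iCycles_d i j) :=
      { τ₁ := 𝟙 _, τ₂ := 𝟙 _, τ₃ := K.iCycles j }
    have : Epi φ.τ₁ := inferInstanceAs (Epi (𝟙 _))
    have : IsIso φ.τ₂ := inferInstanceAs (IsIso (𝟙 _))
    have : Mono φ.τ₃ := inferInstanceAs (Mono (K.iCycles j))
    exact (ShortComplex.exact_iff_of_epi_of_isIso_of_mono φ).2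
      (ShortComplex.exact_of_f_is_kernel _ (K.cyclesIsKernel i j hj))
  · subst hi
    exact (hK j).epi_toCycles

end HomExact

section Gorenstein

variable {A : Type u} [Category.{v} A] [Abelian A]

/-- An object of a class that is closed under cosyzygies and syzygies has a complete resolution,
spliced from a bi-infinite chain of cosyzygies through the object. -/
lemma gproj_of_isCosyzygyClosed {Z : ObjectProperty A} (hZ : IsCosyzygyClosed Z) {X : A}
    (hX : Z X) : Gproj A X := by
  obtain ⟨z, rfl, hz⟩ := exists_int_chain hZ.exists_right hZ.exists_left hX (0 + 1)
  choose P f g w hS hP hQ using hz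
  refine ⟨splice w, splice_acyclic hS, hP, fun Q hQ' j => ?_,
    nonempty_iso_opcycles_splice hS 0⟩
  obtain ⟨i, rfl⟩ : ∃ i, j = i + 1 := ⟨j - 1, by ring⟩
  rw [exact_sc_op_map_iff _ _ rfl rfl, splice_d, splice_d]
  change ∀ a : P (i + 1) ⟶ Q, (g i ≫ f (i + 1)) ≫ a = 0 →
    ∃ b : P (i + 1 + 1) ⟶ Q, (g (i + 1) ≫ f (i + 1 + 1)) ≫ b = a
  intro a ha
  have := (hS i).epi_g
  have h0 : f (i + 1) ≫ a = 0 := (cancel_epi (g i)).1 (by rw [← Category.assoc, ha, comp_zero])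
  obtain ⟨c, hc⟩ : ∃ c : z (i + 1 + 1) ⟶ Q, g (i + 1) ≫ c = a :=
    ⟨_, (CokernelCofork.IsColimit.desc' (hS (i + 1)).gIsCokernel a h0).2⟩
  obtain ⟨b, rfl⟩ := hQ (i + 1 + 1) hQ' c
  exact ⟨b, by rw [Category.assoc, hc]⟩

lemma exists_isCosyzygyClosed_of_gproj {X : A} (hX : Gproj A X) :
    ∃ Z : ObjectProperty A, IsCosyzygyClosed Z ∧ ∃ Y, Z Y ∧ Nonempty (X ≅ Y) := by
  obtain ⟨P, hP, hP', hQ, ⟨e⟩⟩ := hX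
  have key (i j : ℤ) (h : i + 1 = j) : IsCosyzygy (P.opcycles i) (P.opcycles j) := by
    obtain ⟨w, hw⟩ := shortExact_opcycles hP h
    refine ⟨_, _, _, w, hw, hP' j, fun Q hQ' a => ?_⟩
    obtain ⟨b, hb⟩ := (exact_sc_op_map_iff P Q (sub_add_cancel i 1) h).1 (hQ Q hQ' i)
      (P.pOpcycles i ≫ a) (by rw [P.d_pOpcycles_assoc, zero_comp])
    exact ⟨b, by rw [← cancel_epi (P.pOpcycles i), P.p_fromOpcycles_assoc, hb]⟩
  refine ⟨fun Y => ∃ i, Y = P.opcycles i, ⟨?_, ?_⟩, _, ⟨0, rfl⟩, ⟨e⟩⟩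
  · rintro _ ⟨i, rfl⟩
    exact ⟨_, ⟨i + 1, rfl⟩, key _ _ rfl⟩
  · rintro _ ⟨i, rfl⟩
    exact ⟨_, ⟨i - 1, rfl⟩, key _ _ (by ring)⟩

/-- A cosyzygy in `Aᵒᵖ` is the kernel in `A` of an epimorphism from an injective object along which
all morphisms from injective objects lift. -/
lemma isCosyzygy_op_iff {X Y : A} : IsCosyzygy (Opposite.op Y) (Opposite.op X) ↔
    ∃ (I : A) (f : X ⟶ I) (g : I ⟶ Y) (w : f ≫ g = 0), (ShortComplex.mk f g w).ShortExact ∧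
      Injective I ∧ ∀ ⦃J : A⦄, Injective J → ∀ a : J ⟶ Y, ∃ b : J ⟶ I, b ≫ g = a := by
  constructor
  · rintro ⟨P, f, g, w, hS, hP, hQ⟩
    refine ⟨P.unop, g.unop, f.unop, congrArg Quiver.Hom.unop w, hS.unop, inferInstance,
      fun J hJ a => ?_⟩
    obtain ⟨b, hb⟩ := hQ (Q := Opposite.op J) inferInstance a.op
    exact ⟨b.unop, congrArg Quiver.Hom.unop hb⟩
  · rintro ⟨I, f, g, w, hS, hI, hJ⟩
    refine ⟨Opposite.op I, g.op, f.op, congrArg Quiver.Hom.op w, hS.op, inferInstance,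
      fun Q hQ a => ?_⟩
    obtain ⟨b, hb⟩ := hJ (J := Q.unop) inferInstance a.unop
    exact ⟨b.op, congrArg Quiver.Hom.op hb⟩

lemma ginj_of_isCosyzygyClosed {Z : ObjectProperty Aᵒᵖ} (hZ : IsCosyzygyClosed Z) {X : A}
    (hX : Z (Opposite.op X)) : Ginj A X := by
  obtain ⟨z, h0, hz⟩ := exists_int_chain (s := fun Y : A => Z (Opposite.op Y))
    (R := fun X Y => IsCosyzygy (Opposite.op Y) (Opposite.op X))
    (fun Y hY => let ⟨W, hW, h⟩ := hZ.exists_left _ hY; ⟨W.unop, hW, h⟩)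
    (fun Y hY => let ⟨W, hW, h⟩ := hZ.exists_right _ hY; ⟨W.unop, hW, h⟩) hX 0
  obtain rfl := h0
  simp only [isCosyzygy_op_iff] at hz
  choose I f g w hS hI hJ using hz
  refine ⟨splice w, splice_acyclic hS, hI, fun J hJ' j => ?_, nonempty_iso_cycles_splice hS 0⟩
  obtain ⟨i, rfl⟩ : ∃ i, j = i + 1 := ⟨j - 1, by ring⟩
  rw [exact_sc_map_iff _ _ rfl rfl, splice_d, splice_d]
  change ∀ a : J ⟶ I (i + 1), a ≫ g (i + 1) ≫ f (i + 1 + 1) = 0 →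
    ∃ b : J ⟶ I i, b ≫ g i ≫ f (i + 1) = a
  intro a ha
  have := (hS (i + 1 + 1)).mono_f
  have h0 : a ≫ g (i + 1) = 0 :=
    (cancel_mono (f (i + 1 + 1))).1 (by rw [Category.assoc, ha, zero_comp])
  obtain ⟨c, hc⟩ : ∃ c : J ⟶ z (i + 1), c ≫ f (i + 1) = a :=
    ⟨_, (KernelFork.IsLimit.lift' (hS (i + 1)).fIsKernel a h0).2⟩
  obtain ⟨b, rfl⟩ := hJ i hJ' c
  exact ⟨b, by rw [← Category.assoc, hc]⟩

lemma exists_isCosyzygyClosed_of_ginj {X : A} (hX : Ginj A X) :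
    ∃ Z : ObjectProperty Aᵒᵖ, IsCosyzygyClosed Z ∧
      ∃ Y : A, Z (Opposite.op Y) ∧ Nonempty (X ≅ Y) := by
  obtain ⟨I, hI, hI', hJ, ⟨e⟩⟩ := hX
  have key (i j : ℤ) (h : i + 1 = j) :
      IsCosyzygy (Opposite.op (I.cycles j)) (Opposite.op (I.cycles i)) := by
    obtain ⟨w, hw⟩ := shortExact_cycles hI h
    refine isCosyzygy_op_iff.2 ⟨_, _, _, w, hw, hI' i, fun J hJ' a => ?_⟩
    obtain ⟨b, hb⟩ := (exact_sc_map_iff I J h rfl).1 (hJ J hJ' j)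
      (a ≫ I.iCycles j) (by rw [Category.assoc, I.iCycles_d, comp_zero])
    exact ⟨b, by rw [← cancel_mono (I.iCycles j), Category.assoc, I.toCycles_i, hb]⟩
  refine ⟨fun Y => ∃ i, Y = Opposite.op (I.cycles i), ⟨?_, ?_⟩, _, ⟨0, rfl⟩, ⟨e⟩⟩
  · rintro _ ⟨i, rfl⟩
    exact ⟨_, ⟨i - 1, rfl⟩, key _ _ (by ring)⟩
  · rintro _ ⟨i, rfl⟩
    exact ⟨_, ⟨i + 1, rfl⟩, key _ _ rfl⟩

end Gorenstein

/-! ### The heart of the derived category -/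

open DerivedCategory
open scoped CategoryTheory.Pretriangulated.Opposite

section DerivedHeart

variable {A : Type u} [Category.{v} A] [Abelian A] [HasDerivedCategory.{w} A]

lemma heart_singleFunctor_obj (X : A) :
    (TStructure.t (C := A)).heart ((singleFunctor A 0).obj X) :=
  ⟨TStructure.t.le_of_isLE _ 0, TStructure.t.ge_of_isGE _ 0⟩

lemma exists_iso_of_heart (M : DerivedCategory A) (hM : TStructure.t.heart M) :
    ∃ X : A, Nonempty ((singleFunctor A 0).obj X ≅ M) := by
  have : M.IsLE 0 := ⟨hM.1⟩
  have : M.IsGE 0 := ⟨hM.2⟩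
  obtain ⟨X, ⟨e⟩⟩ := M.exists_iso_singleFunctor_obj_of_isGE_of_isLE 0
  exact ⟨X, ⟨e.symm⟩⟩

variable (A) in
lemma isHeartEmbedding_singleFunctor :
    IsHeartEmbedding TStructure.t (singleFunctor A 0) where
  heart_obj := heart_singleFunctor_obj
  exists_iso := exists_iso_of_heart
  exists_distTriang S hS := ⟨_, hS.singleTriangle_distinguished⟩
  heartProj_obj P _ := by
    refine ⟨heart_singleFunctor_obj P, fun M f hM => ?_⟩
    obtain ⟨K, e, _⟩ := hM
    have h : f ≫ e.hom = 0 := from_singleFunctor_obj_eq_zero_of_projective (P := P) (L := K)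
      (i := 0) (f ≫ e.hom) (-1) (by lia)
    rw [← cancel_mono e.hom, h, zero_comp]

variable (A) in
lemma isHeartEmbedding_singleFunctor_op :
    IsHeartEmbedding (opTStructure TStructure.t) (singleFunctor A 0).op where
  heart_obj X := (heart_singleFunctor_obj X.unop).symm
  exists_iso M hM := by
    obtain ⟨X, ⟨e⟩⟩ := exists_iso_of_heart M.unop hM.symm
    exact ⟨Opposite.op X, ⟨e.symm.op⟩⟩
  exists_distTriang S hS := ⟨_, op_distinguished _ hS.unop.singleTriangle_distinguished⟩
  heartProj_obj P hP := by
    refine ⟨(heart_singleFunctor_obj P.unop).symm, fun M f hM => ?_⟩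
    obtain ⟨K, e, _⟩ : TStructure.t.ge 1 M.unop := hM
    have h : e.inv ≫ f.unop = 0 := to_singleFunctor_obj_eq_zero_of_injective (I := P.unop)
      (K := K) (i := 0) (e.inv ≫ f.unop) 1 (by lia)
    refine Quiver.Hom.unop_inj ?_
    rw [← cancel_epi e.inv, h]
    exact comp_zero.symm

end DerivedHeart

/-! ### Levels and exact functors -/

section Functor

universe v' u'

variable {T : Type u} [Category.{v} T] [Preadditive T] [HasZeroObject T] [HasShift T ℤ]
  [∀ n : ℤ, (shiftFunctor T n).Additive] [Pretriangulated T]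
variable {T' : Type u'} [Category.{v'} T'] [Preadditive T'] [HasZeroObject T'] [HasShift T' ℤ]
  [∀ n : ℤ, (shiftFunctor T' n).Additive] [Pretriangulated T']
  (F : T ⥤ T') [F.CommShift ℤ] [F.IsTriangulated] [F.Additive]

lemma angle_map {P : ObjectProperty T} {M : T} (hM : angle P M) : angle (P.map F) (F.obj M) := by
  obtain ⟨n, f, b, N, hf, ⟨hb⟩, ⟨e⟩⟩ := hM
  have := preservesBinaryBiproducts_of_preservesBiproducts F
  refine ⟨n, _, F.mapBicone b, F.obj N, fun i => ?_, ⟨isBilimitOfPreserves F hb⟩,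
    ⟨(F.mapBiprod M N).symm ≪≫ F.mapIso e⟩⟩
  obtain ⟨A, a, i, hA⟩ := hf i
  exact ⟨F.obj A, a, F.mapIso i ≪≫ (F.commShiftIso a).app A, prop_map_obj _ _ hA⟩

lemma extensionProduct_map {P Q : ObjectProperty T} :
    (P ∗ Q).map F ≤ (P.map F ∗ Q.map F) := by
  rintro M ⟨X, ⟨A, B, f, g, h, hT, hA, hB⟩, ⟨e⟩⟩
  exact prop_of_iso _ e ⟨_, _, _, _, _, F.map_distinguished _ hT, prop_map_obj _ _ hA,
    prop_map_obj _ _ hB⟩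

lemma angle_map_le {P : ObjectProperty T} : (angle P).map F ≤ angle (P.map F) := by
  rintro M ⟨X, hX, ⟨e⟩⟩
  obtain ⟨n, f, b, N, hf, hb, ⟨e'⟩⟩ := angle_map F hX
  exact ⟨n, f, b, N, hf, hb, ⟨biprod.mapIso e.symm (Iso.refl _) ≪≫ e'⟩⟩

/-- An exact functor does not increase levels. -/
lemma angleIter_map {P : ObjectProperty T} (r : ℕ) {M : T} (hM : angleIter P r M) :
    angleIter (P.map F) r (F.obj M) := by
  suffices ∀ r, (angleIter P (r + 1)).map F ≤ angleIter (P.map F) (r + 1) by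
    cases r with
    | zero => exact F.map_isZero hM
    | succ r => exact this r _ (prop_map_obj _ _ hM)
  intro r
  induction r with
  | zero => exact angle_map_le F
  | succ r ih =>
    exact (angle_map_le F).trans (angle_mono ((extensionProduct_map F).trans
      (extensionProduct_mono ih (angle_map_le F))))

end Functor

/-! ### Complexes that represent objects of the derived category -/

section Complexes

variable {A : Type u} [Category.{v} A] [Abelian A] [HasDerivedCategory.{w} A]

/-- `M` is isomorphic to a complex of objects of `P` in degrees `a, …, b`. -/
def HasComplexIn (P : ObjectProperty A) (a b : ℤ) (M : DerivedCategory A) : Prop :=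
  ∃ K : CochainComplex A ℤ, (∀ i, a ≤ i → i ≤ b → P (K.X i)) ∧
    (∀ i, ¬ (a ≤ i ∧ i ≤ b) → IsZero (K.X i)) ∧ Nonempty (Q.obj K ≅ M)

lemma hasComplexIn_of_isZero {P : ObjectProperty A} {a b : ℤ} (hab : b < a) {M : DerivedCategory A}
    (hM : IsZero M) : HasComplexIn P a b M :=
  ⟨0, fun i hi hi' => by lia, fun i _ => (HomologicalComplex.eval A _ i).map_isZero (isZero_zero _),
    ⟨(Q.map_isZero (isZero_zero _)).iso hM⟩⟩

/-- A morphism in the derived category from an object in degree `n` to a complex in degrees `≥ n`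
comes from a morphism of complexes. -/
lemma exists_Q_map_eq {X : A} {n : ℤ} {K : CochainComplex A ℤ} [K.IsStrictlyGE n]
    (f : Q.obj ((CochainComplex.singleFunctor A n).obj X) ⟶ Q.obj K) : ∃ g, Q.map g = f := by
  obtain ⟨L, _, _, s, hs, g, rfl⟩ := right_fac_of_isStrictlyLE_of_isStrictlyGE n n f
  obtain ⟨Y, ⟨e⟩⟩ : ∃ Y, Nonempty (L ≅ (CochainComplex.singleFunctor A n).obj Y) :=
    L.exists_iso_single n
  obtain ⟨φ, hφ⟩ := (CochainComplex.singleFunctor A n).map_surjective (e.inv ≫ s)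
  have h1 : (singleFunctor A n).map φ = Q.map (e.inv ≫ s) := congrArg Q.map hφ
  have : IsIso ((singleFunctor A n).map φ) := by
    rw [h1, Functor.map_comp]
    exact IsIso.comp_isIso' (Q.mapIso e).isIso_inv hs
  have : IsIso φ := isIso_of_reflects_iso φ (singleFunctor A n)
  have : IsIso (e.inv ≫ s) := by rw [← hφ]; infer_instance
  have : IsIso s := IsIso.of_isIso_comp_left e.inv s
  exact ⟨inv s ≫ g, by simp⟩

lemma nonempty_iso_single {N : DerivedCategory A} {X : A} {a b : ℤ} (h : a + 1 = b)
    (e : (singleFunctor A 0).obj X ≅ N⟦a⟧) :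
    Nonempty (Q.obj ((CochainComplex.singleFunctor A b).obj X) ≅ N⟦(-1 : ℤ)⟧) := by
  have e₁ : ((singleFunctor A b).obj X)⟦b⟧ ≅ N⟦(-1 : ℤ)⟧⟦b⟧ :=
    ((singleFunctors A).shiftIso b 0 b (by lia)).app X ≪≫ e ≪≫
      (shiftFunctorAdd' (DerivedCategory A) (-1) b a (by lia)).app N
  exact ⟨(shiftFunctor (DerivedCategory A) b).preimageIso e₁⟩

/-- The extension of an object in degree `a` by a complex in degrees `a + 1, …, b` is a complex in
degrees `a, …, b`: it is the mapping cone of a morphism of complexes, by `exists_Q_map_eq`. -/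
lemma hasComplexIn_of_distTriang {P : ObjectProperty A} [P.IsClosedUnderIsomorphisms]
    {a b : ℤ} (hab : a ≤ b) {Y M N : DerivedCategory A} {f : Y ⟶ M} {g : M ⟶ N}
    {h : N ⟶ Y⟦(1 : ℤ)⟧} (hT : Triangle.mk f g h ∈ distTriang _)
    (hY : HasComplexIn P (a + 1) b Y) {X : A} (hX : P X)
    (e : (singleFunctor A 0).obj X ≅ N⟦a⟧) : HasComplexIn P a b M := by
  obtain ⟨K, hK, hK', ⟨eY⟩⟩ := hY
  have : K.IsStrictlyGE (a + 1) := by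
    rw [CochainComplex.isStrictlyGE_iff]
    exact fun i hi => hK' i (by lia)
  obtain ⟨eN⟩ := nonempty_iso_single rfl e
  obtain ⟨k, hk⟩ : ∃ k : N⟦(-1 : ℤ)⟧ ⟶ Y, (Triangle.mk f g h).invRotate.mor₁ = k := ⟨_, rfl⟩
  obtain ⟨φ, hφ⟩ := exists_Q_map_eq (K := K) (eN.hom ≫ k ≫ eY.inv)
  have eX (i : ℤ) : (CochainComplex.mappingCone φ).X i ≅
      ((CochainComplex.singleFunctor A (a + 1)).obj X).X (i + 1) ⊞ K.X i :=
    HomologicalComplex.homotopyCofiber.XIsoBiprod φ i (i + 1) rfl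
  have hz (i : ℤ) (hi : i ≠ a) :
      IsZero (((CochainComplex.singleFunctor A (a + 1)).obj X).X (i + 1)) :=
    HomologicalComplex.isZero_single_obj_X _ _ _ _ (by lia)
  refine ⟨CochainComplex.mappingCone φ, fun i hi hi' => ?_, fun i hi => ?_, ?_⟩
  · obtain rfl | hia := eq_or_ne i a
    · exact P.prop_of_iso ((HomologicalComplex.singleObjXSelf _ (i + 1) X).symm ≪≫
        isoBiprodZero (hK' i (by lia)) ≪≫ (eX i).symm) hX
    · exact P.prop_of_iso (isoZeroBiprod (hz i hia) ≪≫ (eX i).symm) (hK i (by lia) hi')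
  · exact IsZero.of_iso ((biprod_isZero_iff _ _).2 ⟨hz i (by lia), hK' i (by lia)⟩) (eX i)
  · let e₃ := isoTriangleOfIso₁₂ _ _ (mappingCone_triangle_distinguished φ)
      (inv_rot_of_distTriang _ hT) eN eY (by
        rw [hk]
        change Q.map φ ≫ eY.hom = eN.hom ≫ k
        rw [hφ]
        simp)
    exact ⟨Triangle.π₃.mapIso e₃⟩

/-- A tower of objects of the heart is a bounded complex. -/
lemma hasComplexIn_of_tower {P : ObjectProperty A} [P.IsClosedUnderIsomorphisms]
    {G : ObjectProperty (DerivedCategory A)} [G.IsClosedUnderIsomorphisms]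
    (hG : G ≤ P.map (singleFunctor A 0)) {b : ℤ}
    {n : ℕ} {M : DerivedCategory A} (hM : tower G b n M) : HasComplexIn P (b - n + 1) b M := by
  induction n generalizing M with
  | zero => exact hasComplexIn_of_isZero (by lia) hM
  | succ n ih =>
    rw [tower_succ'] at hM
    obtain ⟨Y, N, f, g, h, hT, hY, hN⟩ := hM
    obtain ⟨X, hX, ⟨e⟩⟩ := hG _ hN
    have hY' := ih hY
    rw [show b - (n + 1 : ℕ) + 1 = b - n by push_cast; ring]
    exact hasComplexIn_of_distTriang (by lia) hT hY' hX e

/-- The dual of `hasComplexIn_of_tower`; the tower starts with the term of lowest degree. -/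
lemma hasComplexIn_of_tower_op {P : ObjectProperty A} [P.IsClosedUnderIsomorphisms]
    {G : ObjectProperty (DerivedCategory A)ᵒᵖ} [G.IsClosedUnderIsomorphisms]
    (hG : ∀ N, G N → P.map (singleFunctor A 0) N.unop) {b : ℤ}
    {n : ℕ} {M : (DerivedCategory A)ᵒᵖ} (hM : tower G b n M) :
    HasComplexIn P (-b) (-b + n - 1) M.unop := by
  induction n generalizing b M with
  | zero => exact hasComplexIn_of_isZero (by lia) (IsZero.unop hM)
  | succ n ih =>
    obtain ⟨N, Y, f, g, h, hT, hN, hY⟩ := hM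
    obtain ⟨X, hX, ⟨e⟩⟩ := hG _ (G.prop_of_iso
      ((shiftFunctorOpIso (DerivedCategory A) b (-b) (by lia)).app N) hN)
    have hY' := ih hY
    rw [show -(b - 1) = -b + 1 by ring, show -b + 1 + (n : ℤ) - 1 = -b + (n + 1 : ℕ) - 1 by
      push_cast; ring] at hY'
    exact hasComplexIn_of_distTriang (by lia) (unop_distinguished _ hT) hY' hX e

end Complexes

/-! ### Levels and (co)resolution dimensions -/

section Dimensions

variable {A : Type u} [Category.{v} A] [Abelian A] [HasDerivedCategory.{w} A]

/-- For a nonzero bounded object, `cohInf` and `cohSup` are integers. -/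
lemma exists_cohInf_cohSup (M : DerivedCategory A) (hM : ¬ IsZero M)
    (hb : (TStructure.t (C := A)).bounded M) :
    ∃ i s : ℤ, i ≤ s ∧ cohInf M = ((i : ℝ) : EReal) ∧ cohSup M = ((s : ℝ) : EReal) ∧
      TStructure.t.ge i M ∧ TStructure.t.le s M := by
  obtain ⟨⟨a, ha⟩, ⟨b, hb⟩⟩ := hb
  have ha : M.IsGE a := ha
  have hb : M.IsLE b := hb
  let H : ℤ → Prop := fun i => ¬ IsZero ((homologyFunctor A i).obj M)
  have hHa (i : ℤ) (hi : H i) : a ≤ i := by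
    by_contra! h
    exact hi (M.isZero_of_isGE a i h)
  have hHb (i : ℤ) (hi : H i) : i ≤ b := by
    by_contra! h
    exact hi (M.isZero_of_isLE b i h)
  have hH : ∃ i, H i := by
    by_contra! h
    have h (i : ℤ) : IsZero ((homologyFunctor A i).obj M) := not_not.1 (h i)
    exact hM (isZero_of_le_of_ge (t := TStructure.t) (show (0 : ℤ) < 1 by lia)
      ((isLE_iff M 0).2 fun i _ => h i).le ((isGE_iff M 1).2 fun i _ => h i).ge)
  obtain ⟨i, hi, hi'⟩ := Int.exists_least_of_bdd ⟨a, hHa⟩ hH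
  obtain ⟨s, hs, hs'⟩ := Int.exists_greatest_of_bdd ⟨b, hHb⟩ hH
  refine ⟨i, s, hi' s hs, ?_, ?_, ((isGE_iff M i).2 fun j hj => ?_).ge,
    ((isLE_iff M s).2 fun j hj => ?_).le⟩
  · refine IsLeast.csInf_eq ⟨⟨i, hi, rfl⟩, ?_⟩
    rintro _ ⟨j, hj, rfl⟩
    exact_mod_cast hi' j hj
  · refine IsGreatest.csSup_eq ⟨⟨s, hs, rfl⟩, ?_⟩
    rintro _ ⟨j, hj, rfl⟩
    exact_mod_cast hs' j hj
  · by_contra h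
    exact absurd (hi' j h) (by lia)
  · by_contra h
    exact absurd (hs' j h) (by lia)

lemma isoComplexIn_of_hasComplexIn {P : ObjectProperty A} {a b : ℤ} {M : DerivedCategory A}
    (h : HasComplexIn P a b M) : IsoComplexIn P ((a : ℝ) : EReal) ((b : ℝ) : EReal) M := by
  obtain ⟨K, hK, hK', e⟩ := h
  refine ⟨K, fun i hi hi' => hK i (by exact_mod_cast hi) (by exact_mod_cast hi'),
    fun i hi => hK' i fun h => hi ⟨by exact_mod_cast h.1, by exact_mod_cast h.2⟩, e⟩

lemma not_isZero_obj {M : Bounded A} (hM : ¬ IsZero M) : ¬ IsZero M.obj := fun h =>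
  hM ((IsZero.iff_id_eq_zero M).2 (Bounded.ι.map_injective (h.eq_of_src _ _)))

/-- Levels in the bounded derived category bound levels in the derived category. -/
lemma angleIter_obj {P : ObjectProperty A} {M : Bounded A} {r : ℕ}
    (hM : angleIter (P.map (toBounded A)) r M) :
    angleIter (P.map (singleFunctor A 0)) r M.obj := by
  refine angleIter_mono ?_ _ _ (angleIter_map Bounded.ι r hM)
  rintro X ⟨Y, ⟨Z, hZ, ⟨e⟩⟩, ⟨e'⟩⟩
  exact ⟨Z, hZ, ⟨Bounded.ι.mapIso e ≪≫ e'⟩⟩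

/-- The level bound for a class `P` of objects that corresponds to a resolving class of the
heart. -/
lemma resolDim_le_level {P : ObjectProperty A} [P.IsClosedUnderIsomorphisms]
    (ht : EnoughProj (TStructure.t (C := A)))
    (hP : IsResolving TStructure.t (P.map (singleFunctor A 0))) {M : Bounded A}
    (hM : ¬ IsZero M) :
    resolDim P M.obj + cohInf M.obj + 1 ≤ levelBounded P M := by
  obtain ⟨i, s, his, hi, hs, hi', hs'⟩ :=
    exists_cohInf_cohSup M.obj (not_isZero_obj hM) M.property
  refine le_sInf ?_
  rintro _ ⟨r, hr, rfl⟩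
  cases r with
  | zero => exact absurd hr hM
  | succ r =>
    have h := isoComplexIn_of_hasComplexIn (hasComplexIn_of_tower le_rfl
      (tower_of_angleIter ht hP (angleIter_obj hr) his hs' hi'))
    have hd : resolDim P M.obj ≤ (((r - i : ℤ) : ℝ) : EReal) := by
      rw [resolDim, if_neg (not_isZero_obj hM)]
      refine sInf_le ⟨r - i, ?_, rfl⟩
      rw [hs]
      convert h using 1
      rw [← EReal.coe_neg, ← Int.cast_neg]
      congr 2
      push_cast
      lia
    calc resolDim P M.obj + cohInf M.obj + 1
        ≤ (((r - i : ℤ) : ℝ) : EReal) + ((i : ℝ) : EReal) + 1 := by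
          rw [hi]
          gcongr
      _ = ((r + 1 : ℕ) : EReal) := by
          rw [← EReal.coe_add]
          rw [← EReal.coe_natCast, ← EReal.coe_one, ← EReal.coe_add]
          congr 1
          push_cast
          ring

/-- The level bound for a class `P` of objects that corresponds to a resolving class of the heart
of the opposite t-structure. -/
lemma coresolDim_le_level {P : ObjectProperty A} [P.IsClosedUnderIsomorphisms]
    (ht : EnoughProj (opTStructure (TStructure.t (C := A))))
    (hP : IsResolving (opTStructure TStructure.t) (P.map (singleFunctor A 0)).op)
    {M : Bounded A} (hM : ¬ IsZero M) :
    coresolDim P M.obj - cohSup M.obj + 1 ≤ levelBounded P M := by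
  obtain ⟨i, s, his, hi, hs, hi', hs'⟩ :=
    exists_cohInf_cohSup M.obj (not_isZero_obj hM) M.property
  refine le_sInf ?_
  rintro _ ⟨r, hr, rfl⟩
  cases r with
  | zero => exact absurd hr hM
  | succ r =>
    have h := isoComplexIn_of_hasComplexIn (hasComplexIn_of_tower_op
      (G := (P.map (singleFunctor A 0)).op) (fun _ hN => hN)
      (tower_op_of_angleIter ht hP (angleIter_obj hr) his hs' hi'))
    have hd : coresolDim P M.obj ≤ (((s + r : ℤ) : ℝ) : EReal) := by
      rw [coresolDim, if_neg (not_isZero_obj hM)]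
      refine sInf_le ⟨s + r, ?_, rfl⟩
      rw [hi]
      convert h using 1
      · rw [neg_neg]
      · congr 2
        push_cast
        lia
    calc coresolDim P M.obj - cohSup M.obj + 1
        ≤ (((s + r : ℤ) : ℝ) : EReal) - ((s : ℝ) : EReal) + 1 := by
          rw [hs]
          gcongr
          exact EReal.sub_le_sub hd le_rfl
      _ = ((r + 1 : ℕ) : EReal) := by
          rw [← EReal.coe_sub]
          rw [← EReal.coe_natCast, ← EReal.coe_one, ← EReal.coe_add]
          congr 1
          push_cast
          ring

end Dimensions

section Classes

variable {A : Type u} [Category.{v} A] [Abelian A] [HasDerivedCategory.{w} A]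

instance : (isProjective A).IsClosedUnderIsomorphisms where
  of_iso e h := by
    have : Projective _ := h
    exact Projective.of_iso e this

instance : (isInjective A).IsClosedUnderIsomorphisms where
  of_iso e h := by
    have : Injective _ := h
    exact Injective.of_iso e this

instance : (Gproj A).IsClosedUnderIsomorphisms where
  of_iso e := fun ⟨P, h₁, h₂, h₃, ⟨e'⟩⟩ => ⟨P, h₁, h₂, h₃, ⟨e.symm ≪≫ e'⟩⟩

instance : (Ginj A).IsClosedUnderIsomorphisms where
  of_iso e := fun ⟨P, h₁, h₂, h₃, ⟨e'⟩⟩ => ⟨P, h₁, h₂, h₃, ⟨e.symm ≪≫ e'⟩⟩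

lemma map_isProjective_eq_heartProj :
    (isProjective A).map (singleFunctor A 0) = heartProj TStructure.t := by
  have hF := isHeartEmbedding_singleFunctor A
  refine le_antisymm ?_ fun M hM => ?_
  · rintro M ⟨X, hX, ⟨e⟩⟩
    exact prop_of_iso _ e (hF.heartProj_obj X hX)
  · obtain ⟨X, ⟨e⟩⟩ := hF.exists_iso M hM.1
    exact ⟨X, hF.projective_of_heartProj (prop_of_iso _ e.symm hM), ⟨e⟩⟩

lemma map_gproj_eq_heartGproj [EnoughProjectives A] :
    (Gproj A).map (singleFunctor A 0) = heartGproj TStructure.t := by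
  have hF := isHeartEmbedding_singleFunctor A
  refine le_antisymm ?_ fun M hM => ?_
  · rintro M ⟨X, hX, ⟨e⟩⟩
    obtain ⟨Z, hZ, Y, hY, ⟨e'⟩⟩ := exists_isCosyzygyClosed_of_gproj hX
    exact prop_of_iso _ (((singleFunctor A 0).mapIso e').symm ≪≫ e)
      (hF.heartGproj_of_isCosyzygyClosed hZ hY)
  · obtain ⟨X, ⟨e⟩⟩ := hF.exists_iso M (heartGproj_le_heartPerp M hM).1
    exact ⟨X, gproj_of_isCosyzygyClosed hF.isCosyzygyClosed
      (prop_of_iso (heartGproj _) e.symm hM), ⟨e⟩⟩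

lemma map_isInjective_op_eq_heartProj :
    ((isInjective A).map (singleFunctor A 0)).op = heartProj (opTStructure TStructure.t) := by
  have hF := isHeartEmbedding_singleFunctor_op A
  refine le_antisymm ?_ fun M hM => ?_
  · rintro M ⟨X, hX, ⟨e⟩⟩
    have : Injective X := hX
    exact prop_of_iso _ e.symm.op (hF.heartProj_obj (Opposite.op X) inferInstance)
  · obtain ⟨X, ⟨e⟩⟩ := hF.exists_iso M hM.1
    have : Projective X := hF.projective_of_heartProj (prop_of_iso _ e.symm hM)
    exact ⟨X.unop, (inferInstance : Injective X.unop), ⟨e.symm.unop⟩⟩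

lemma map_ginj_op_eq_heartGproj [EnoughInjectives A] :
    ((Ginj A).map (singleFunctor A 0)).op = heartGproj (opTStructure TStructure.t) := by
  have hF := isHeartEmbedding_singleFunctor_op A
  refine le_antisymm ?_ fun M hM => ?_
  · rintro M ⟨X, hX, ⟨e⟩⟩
    obtain ⟨Z, hZ, Y, hY, ⟨e'⟩⟩ := exists_isCosyzygyClosed_of_ginj hX
    exact prop_of_iso _ (((singleFunctor A 0).mapIso e').symm ≪≫ e).symm.op
      (hF.heartGproj_of_isCosyzygyClosed hZ hY)
  · obtain ⟨X, ⟨e⟩⟩ := hF.exists_iso M (heartGproj_le_heartPerp M hM).1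
    exact ⟨X.unop, ginj_of_isCosyzygyClosed hF.isCosyzygyClosed
      (prop_of_iso (heartGproj _) e.symm hM), ⟨e.symm.unop⟩⟩

lemma enoughProj_of_enoughProjectives [EnoughProjectives A] :
    EnoughProj (TStructure.t (C := A)) :=
  enoughProj_of_heart (isHeartEmbedding_singleFunctor A).heart_le_heartProj

lemma enoughProj_op_of_enoughInjectives [EnoughInjectives A] :
    EnoughProj (opTStructure (TStructure.t (C := A))) :=
  enoughProj_of_heart (isHeartEmbedding_singleFunctor_op A).heart_le_heartProj

lemma pd_le_level [EnoughProjectives A] {M : Bounded A} (hM : ¬ IsZero M) :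
    pd M.obj + cohInf M.obj + 1 ≤ levelBounded (isProjective A) M :=
  resolDim_le_level enoughProj_of_enoughProjectives
    (by rw [map_isProjective_eq_heartProj]; infer_instance) hM

lemma gpd_le_level [EnoughProjectives A] {M : Bounded A} (hM : ¬ IsZero M) :
    Gpd M.obj + cohInf M.obj + 1 ≤ levelBounded (Gproj A) M :=
  resolDim_le_level enoughProj_of_enoughProjectives
    (by rw [map_gproj_eq_heartGproj]; infer_instance) hM

lemma injDim_le_level [EnoughInjectives A] {M : Bounded A} (hM : ¬ IsZero M) :
    injDim M.obj - cohSup M.obj + 1 ≤ levelBounded (isInjective A) M :=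
  coresolDim_le_level enoughProj_op_of_enoughInjectives
    (by rw [map_isInjective_op_eq_heartProj]; infer_instance) hM

lemma gid_le_level [EnoughInjectives A] {M : Bounded A} (hM : ¬ IsZero M) :
    Gid M.obj - cohSup M.obj + 1 ≤ levelBounded (Ginj A) M :=
  coresolDim_le_level enoughProj_op_of_enoughInjectives
    (by rw [map_ginj_op_eq_heartGproj]; infer_instance) hM

end Classes

end LevelBound

theorem mainTheorem4 {A : Type u} [Category.{v} A] [Abelian A] [HasDerivedCategory.{w} A] :
    (EnoughProjectives A → ∀ M : DerivedCategory.Bounded A, ¬ IsZero M →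
      LevelBound.levelBounded (isProjective A) M ≥
        LevelBound.pd M.obj + LevelBound.cohInf M.obj + 1 ∧
      LevelBound.levelBounded (LevelBound.Gproj A) M ≥
        LevelBound.Gpd M.obj + LevelBound.cohInf M.obj + 1) ∧
    (EnoughInjectives A → ∀ M : DerivedCategory.Bounded A, ¬ IsZero M →
      LevelBound.levelBounded (isInjective A) M ≥
        LevelBound.injDim M.obj - LevelBound.cohSup M.obj + 1 ∧
      LevelBound.levelBounded (LevelBound.Ginj A) M ≥
        LevelBound.Gid M.obj - LevelBound.cohSup M.obj + 1) := by
  exact ⟨fun _ M hM => ⟨LevelBound.pd_le_level hM, LevelBound.gpd_le_level hM⟩,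
    fun _ M hM => ⟨LevelBound.injDim_le_level hM, LevelBound.gid_le_level hM⟩⟩
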